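/- **Setting.** Let $N\ge 1$, let $\mathbb T=\{|z|=1\}\subset\mathbb C$, let $C_N=\mathbb T/\{N\text{-th roots of unity}\}$, and let $R\colon C_N\to\mathbb T$, $R([c])=c^N$. Let $D\subset\mathbb R^2=\mathbb C$ be a bounded simply connected domain whose boundary is a piecewise smooth simple closed curve. Let $f\colon\overline D\to C_N\cup\{0\}$ be a boundary-aligned canonical harmonic $N$-direction field on $D$. This means the following, with the convention $R(0)=0$. * At every smooth point of $\partial D$, $R\circ f=\nu^N$, where $\nu$ is the outward unit normal, viewed as a complex number. * On a bounded simply connected domain $\widetilde D\subseteq D$ with piecewise smooth boundary ($\widetilde D=D$ if $\partial D$ is smooth; otherwise $D$ with its corners rounded off), $f$ is the canonical harmonic $N$-direction field for some continuous $g\colon\partial\widetilde D\to\mathbb T$ and some finitely many distinct points $a_j\in\widetilde D$ with indices $d_j\in\mathbb Z$. That is: $f(a_j)=0$ for all $j$; $u=R\circ f$ is a harmonic map from $\widetilde D\setminus\{a_j\}$ to $\mathbb T$ (locally $u=e^{i\varphi}$ with $\varphi$ real and harmonic); $u$ is continuous on $\overline{\widetilde D}\setminus\{a_j\}$; $u=g$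 on $\partial\widetilde D$; and for each $j$ there are constants $C_j$ and $\alpha_j$ with $|\alpha_j|=1$ such that $\bigl|u(z)-\alpha_j\tfrac{(z-a_j)^{d_j}}{|z-a_j|^{d_j}}\bigr|\le C_j|z-a_j|$ for $z$ near $a_j$. * $f\ne0$ on $D\setminus\widetilde D$, and $R\circ f$ is continuous on $\{z\in D: f(z)\neq 0\}$. A zero $a\in D$ of $f$ is an interior singularity of index $q\neq0$ if the argument of $R\circ f$ increases by $2\pi N q$ along every sufficiently small counterclockwise circle around $a$. A streamline of $f$ is a continuous curve $\gamma\colon[s,t]\to\mathbb C$, $s<t$, such that on $(s,t)$ it runs in $\{z\in D:f(z)\ne0\}$ and satisfies $\gamma'=w$ for a continuous $w\colon(s,t)\to\mathbb T$ whose value $w(\tau)$ represents $f(\gamma(\tau))$ for every $\tau$. In other words, $(\gamma,w)$ is an integral curve of the covering vector field on the surface $\{(p,w): p\in D,\ f(p)=[w]\}$. A separatrix beginning (ending) at $a$ is a streamline whose initial (final) point is $a$. Separatrices at $a$ are identified if, parametrized by the time elapsed since leaving $a$ (traversed backwards if they end at $a$), they agree for a short time. **Lemma.** Let $a$ be an interior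 singularity of $f$ of index $d/N$, with $d\in\mathbb Z$ and $d<N$. Then exactly $N-d$ separatrices begin at $a$. If $N$ is even, the separatrices ending at $a$, traversed backwards, are the same $N-d$ separatrices, so that exactly $N-d$ separatrices meet at $a$. These separatrices partition a neighborhood of $a$ into $N-d$ sectors of equal angle. Precisely, there are $\rho>0$ with $B(a,\rho)\subseteq D$ and representatives $\gamma_k\colon[0,T_k]\to\mathbb C$, $k\in\mathbb Z/(N-d)$, of the separatrices beginning at $a$, each occurring exactly once, such that $B(a,\rho)\setminus\bigcup_k\gamma_k([0,T_k))$ is the disjoint union of $N-d$ open sectors $S_k$. The sector $S_k$ extends counterclockwise from the side $\gamma_k([0,T_k))$ to the side $\gamma_{k+1}([0,T_{k+1}))$ and has angle $2\pi/(N-d)$ at $a$. Here, in polar coordinates $z=a+re^{i\theta}$, the two sides are graphs $\theta=\alpha_k(r)$ and $\theta=\beta_k(r)$ of functions continuous on $[0,\rho)$ with $\alpha_k<\beta_k\le\alpha_k+2\pi$, the sector is $S_k=\{a+re^{i\theta}:0<r<\rho,\ \alpha_k(r)<\theta<\beta_k(r)\}$, and its angle at $a$ is $\beta_k(0)-\alpha_k(0)$.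 -/

import Mathlib

open Set Filter Topology

open scoped ContDiff

noncomputable section

/-! ### `N`-directions and `N`-direction fields -/

/-- The group `C_N = 𝕋 / ρ(N)` of `N`-directions, where `ρ(N)` is the group of `N`-th roots of
unity, written as the kernel of `c ↦ c ^ N` on the circle group. -/
abbrev NDirection (N : ℕ) : Type := Circle ⧸ (powMonoidHom N : Circle →* Circle).ker

/-- The representation map `R : C_N → 𝕋`, `R [c] = c ^ N`. -/
def reprMap (N : ℕ) : NDirection N →* Circle :=
  QuotientGroup.kerLift (powMonoidHom N : Circle →* Circle)

/-- The representation field `R ∘ f`, with values in `𝕋 ∪ {0} ⊆ ℂ`, of a field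
`f` with values in `C_N ∪ {0}`. -/
def reprField {N : ℕ} (f : ℂ → WithZero (NDirection N)) (z : ℂ) : ℂ :=
  match f z with
  | none => 0
  | some c => (reprMap N c : ℂ)

theorem reprField_eq_zero_iff {N : ℕ} (f : ℂ → WithZero (NDirection N)) (z : ℂ) :
    reprField f z = 0 ↔ f z = 0 := by
  unfold reprField
  cases h : f z with
  | zero => exact iff_of_true rfl rfl
  | coe c => exact ⟨fun h0 => absurd h0 (Circle.coe_ne_zero _), fun h0 => by cases h0⟩

/-- A unit vector represents the `N`-direction `f z` iff its `N`-th power is `R (f z)`. -/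
theorem eq_mk_iff {N : ℕ} (f : ℂ → WithZero (NDirection N)) (z : ℂ) (w : Circle) :
    f z = ((QuotientGroup.mk w : NDirection N) : WithZero (NDirection N)) ↔
      (w : ℂ) ^ N = reprField f z := by
  have hw : reprMap N (QuotientGroup.mk w) = w ^ N := rfl
  unfold reprField
  cases h : f z with
  | zero => exact ⟨fun h0 => (by cases h0), fun h0 => absurd h0 (pow_ne_zero _ (Circle.coe_ne_zero _))⟩
  | coe c =>
    constructor
    · intro h0
      have : c = QuotientGroup.mk w := WithZero.coe_injective h0
      subst this
      simp [hw]
    · intro h0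
      have h1 : reprMap N (QuotientGroup.mk w) = reprMap N c := by
        rw [hw]; ext; simpa using h0
      have := QuotientGroup.kerLift_injective (powMonoidHom N : Circle →* Circle) h1
      rw [this]

/-! ### Planar domains -/

/-- A bounded simply connected plane domain whose boundary is a simple closed curve that is smooth
and regular on each piece of a finite subdivision of the parameter interval. -/
structure IsPiecewiseSmoothDomain (D : Set ℂ) : Prop where
  isOpen : IsOpen D
  isBounded : Bornology.IsBounded D
  simplyConnected : SimplyConnectedSpace D
  boundary : ∃ (k : ℕ) (t : Fin (k + 2) → ℝ) (c : ℝ → ℂ),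
    StrictMono t ∧ t 0 = 0 ∧ t (Fin.last (k + 1)) = 1 ∧
    ContinuousOn c (Icc 0 1) ∧ c 0 = c 1 ∧ InjOn c (Ico 0 1) ∧ c '' Icc 0 1 = frontier D ∧
    ∀ i : Fin (k + 1),
      ContDiffOn ℝ ∞ c (Icc (t i.castSucc) (t i.succ)) ∧
      ∀ s ∈ Icc (t i.castSucc) (t i.succ), derivWithin c (Icc (t i.castSucc) (t i.succ)) s ≠ 0

/-- `p` is a smooth boundary point of `D` and `ν` is the outward unit normal of `D` at `p`:
near `p` the set `D` is `{h < 0}` for a smooth `h` with `∇h(p) ≠ 0`, and `ν = ∇h(p) / |∇h(p)|`. -/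
def IsOutwardUnitNormal (D : Set ℂ) (p ν : ℂ) : Prop :=
  p ∈ frontier D ∧ ∃ h : ℂ → ℝ, ContDiffAt ℝ ∞ h p ∧ gradient h p ≠ 0 ∧
    (∀ᶠ z in 𝓝 p, z ∈ D ↔ h z < 0) ∧ ν = (‖gradient h p‖⁻¹ : ℝ) • gradient h p

/-- `f` is boundary-aligned to `D`: `R ∘ f = ν ^ N` at every smooth boundary point. -/
def IsBoundaryAligned {N : ℕ} (D : Set ℂ) (f : ℂ → WithZero (NDirection N)) : Prop :=
  ∀ p ν : ℂ, IsOutwardUnitNormal D p ν → reprField f p = ν ^ N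

/-! ### Canonical harmonic maps and fields -/

/-- `u` is, near `z`, a smooth harmonic map into the unit circle. The circle is flat, so in its
angular coordinate the harmonic map equation is `Δφ = 0`, where `u = exp (i φ)`. (This is the
equation `Δu + |∇u|² u = 0` for maps with `|u| = 1`.) -/
def IsCircleHarmonicAt (u : ℂ → ℂ) (z : ℂ) : Prop :=
  ∃ φ : ℂ → ℝ, InnerProductSpace.HarmonicAt φ z ∧
    ∀ᶠ w in 𝓝 z, u w = Complex.exp (φ w * Complex.I)

/-- `u` is the canonical harmonic map on `Ω` for the boundary condition `g` and the singularities
`b 0, …, b (n - 1)` with indices `e 0, …, e (n - 1)`. -/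
structure IsCanonicalHarmonicMap (Ω : Set ℂ) (g : ℂ → Circle) {n : ℕ} (b : Fin n → ℂ)
    (e : Fin n → ℤ) (u : ℂ → ℂ) : Prop where
  harmonic : ∀ z ∈ Ω \ range b, IsCircleHarmonicAt u z
  continuousOn : ContinuousOn u (closure Ω \ range b)
  boundary : ∀ z ∈ frontier Ω, u z = g z
  estimate : ∀ j, ∃ α : ℂ, ‖α‖ = 1 ∧ ∃ C : ℝ, ∀ᶠ z in 𝓝[≠] (b j),
    ‖u z - α * ((z - b j) ^ e j / (‖z - b j‖ : ℂ) ^ e j)‖ ≤ C * ‖z - b j‖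

/-- `f` is the canonical harmonic `N`-direction field `R⁻¹(u)` on `Ω` for the boundary condition
`g`, the points `b` and the indices `e`; it vanishes exactly at the points `b`. -/
structure IsCanonicalHarmonicField {N : ℕ} (Ω : Set ℂ) (g : ℂ → Circle) {n : ℕ} (b : Fin n → ℂ)
    (e : Fin n → ℤ) (f : ℂ → WithZero (NDirection N)) : Prop where
  zero : ∀ j, f (b j) = 0
  canonical : IsCanonicalHarmonicMap Ω g b e (reprField f)

/-- `f` is a boundary-aligned canonical harmonic `N`-direction field on `D`. It is canonical
harmonic on a domain `Ω ⊆ D`, and is continued to `D \ Ω` continuously and without further zeros.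
If `∂D` is smooth one takes `Ω = D`; if `D` has corners, `Ω` is a domain obtained from `D` by
rounding the corners off. -/
structure IsAlignedCanonicalField {N : ℕ} (D : Set ℂ) (f : ℂ → WithZero (NDirection N)) :
    Prop where
  aligned : IsBoundaryAligned D f
  canonical : ∃ Ω ⊆ D, IsPiecewiseSmoothDomain Ω ∧
    (∃ (g : ℂ → Circle) (n : ℕ) (b : Fin n → ℂ) (e : Fin n → ℤ),
      ContinuousOn g (frontier Ω) ∧ Function.Injective b ∧ (∀ j, b j ∈ Ω) ∧
      IsCanonicalHarmonicField Ω g b e f) ∧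
    (∀ z ∈ D \ Ω, f z ≠ 0)
  continuousOn : ContinuousOn (reprField f) {z ∈ D | f z ≠ 0}

/-! ### Index -/

/-- `f` has index `q` at `p`: along every sufficiently small positively oriented circle around `p`
the argument of `R ∘ f` changes by `2πN q`. -/
def HasIndexAt {N : ℕ} (f : ℂ → WithZero (NDirection N)) (p : ℂ) (q : ℝ) : Prop :=
  ∀ᶠ r : ℝ in 𝓝[>] 0, ∃ ϑ : ℝ → ℝ, ContinuousOn ϑ (Icc 0 1) ∧
    (∀ t ∈ Icc (0 : ℝ) 1,
      reprField f (p + r * Complex.exp (2 * Real.pi * t * Complex.I)) =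
        Complex.exp (ϑ t * Complex.I)) ∧
    q = (ϑ 1 - ϑ 0) / (2 * Real.pi * N)

/-- `p` is an interior singularity of `f` of index `q`: a zero in `D` with index `q ≠ 0`. -/
structure IsInteriorSingularity {N : ℕ} (D : Set ℂ) (f : ℂ → WithZero (NDirection N)) (p : ℂ)
    (q : ℝ) : Prop where
  mem : p ∈ D
  zero : f p = 0
  index : HasIndexAt f p q
  ne_zero : q ≠ 0

/-! ### Streamlines and separatrices -/

/-- The covering surface of the multi-valued map `(R ∘ f) ^ (1 / N)`: pairs `(p, w)` of a point
`p ∈ D` with `f p ≠ 0` and a unit vector `w` representing the `N`-direction `f p`. The covering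
vector field is `(p, w) ↦ w` and the projection to `D` is `(p, w) ↦ p`. -/
def coveringSurface {N : ℕ} (D : Set ℂ) (f : ℂ → WithZero (NDirection N)) : Set (ℂ × Circle) :=
  {q | q.1 ∈ D ∧ f q.1 = ((QuotientGroup.mk q.2 : NDirection N) : WithZero (NDirection N))}

/-- `γ : [s, t] → ℂ` is a streamline of `f`: the projection of an integral curve `(γ, w)` of the
covering vector field. The end points of `γ` may be zeros of `f` (where there is no covering
surface), so the differential equation is required on the open interval, and `γ` is required to be
continuous on the closed one. -/
def IsStreamline {N : ℕ} (D : Set ℂ) (f : ℂ → WithZero (NDirection N)) (γ : ℝ → ℂ) (s t : ℝ) :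
    Prop :=
  s < t ∧ ContinuousOn γ (Icc s t) ∧ ∃ w : ℝ → Circle, ContinuousOn w (Ioo s t) ∧
    ∀ τ ∈ Ioo s t, (γ τ, w τ) ∈ coveringSurface D f ∧ HasDerivAt γ (w τ : ℂ) τ

/-- The separatrices of `f` beginning at `a`, as germs at `a`: streamlines that agree for a short
time after leaving `a` are identified. -/
def outgoingSeparatrices {N : ℕ} (D : Set ℂ) (f : ℂ → WithZero (NDirection N)) (a : ℂ) :
    Set (Germ (𝓝[≥] (0 : ℝ)) ℂ) :=
  {G | ∃ (σ : ℝ → ℂ) (s t : ℝ), IsStreamline D f σ s t ∧ σ s = a ∧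
    G = ((fun τ : ℝ => σ (s + τ)) : Germ (𝓝[≥] (0 : ℝ)) ℂ)}

/-- The separatrices of `f` ending at `a`, as germs at `a`, traversed backwards from `a`. -/
def incomingSeparatrices {N : ℕ} (D : Set ℂ) (f : ℂ → WithZero (NDirection N)) (a : ℂ) :
    Set (Germ (𝓝[≥] (0 : ℝ)) ℂ) :=
  {G | ∃ (σ : ℝ → ℂ) (s t : ℝ), IsStreamline D f σ s t ∧ σ t = a ∧
    G = ((fun τ : ℝ => σ (t - τ)) : Germ (𝓝[≥] (0 : ℝ)) ℂ)}

/-! ### Sectors -/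

/-- `S` is the open sector of the disc `B(a, R)` with vertex `a` that extends counterclockwise from
the curve `A` to the curve `B`, and its angle at `a` is `η`. In polar coordinates around `a` the
sides are graphs `θ = α r` and `θ = β r`, continuous up to `r = 0`. -/
def IsSectorOfAngle (a : ℂ) (R : ℝ) (A B : Set ℂ) (η : ℝ) (S : Set ℂ) : Prop :=
  ∃ α β : ℝ → ℝ, ContinuousOn α (Ico 0 R) ∧ ContinuousOn β (Ico 0 R) ∧
    (∀ r ∈ Ico 0 R, α r < β r ∧ β r ≤ α r + 2 * Real.pi) ∧ β 0 - α 0 = η ∧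
    A = (fun r : ℝ => a + r * Complex.exp (α r * Complex.I)) '' Ico 0 R ∧
    B = (fun r : ℝ => a + r * Complex.exp (β r * Complex.I)) '' Ico 0 R ∧
    S = {z | ∃ r ∈ Ioo 0 R, ∃ θ ∈ Ioo (α r) (β r), z = a + r * Complex.exp (θ * Complex.I)}

end

noncomputable section

/-! ### Removable singularities of harmonic functions -/

/-! Write m = N - d ≥ 1 and u = R ∘ f. The proof finds a holomorphic coordinate at a in which the
field becomes, up to positive factors, the model field y ^ d. The streamlines of the model that
leave 0 are exactly the m rays through the m-th roots of unity, so everything is read off there and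
carried back by a conformal map.

Local form (`exists_local_form`, `winding_eq_exponent`). The estimate at a makes u divided by its
leading term close to 1. The argument of this quotient is harmonic and O(|z - a|), hence the real
part of a holomorphic function on the full disc. Thus u = exp(i Re H) ((z - a) / |z - a|) ^ e with H
holomorphic, and the index forces e = d.

Coordinate (`exists_natural_coordinate`). With a = 0, multiplying u by positive numbers turns it
into exp(iH) z ^ d, so W' W ^ (-d/N) should be a constant multiple of z ^ (-d/N) exp(-iH/N). Putting
W ^ (m/N) = z ^ (m/N) K reduces this to the single-valued equation m K + N z K' = exp(-iH/N), which
has a holomorphic solution with K(0) ≠ 0. The local inverse G of W is the chart.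

Model (`model_streamline_eq_ray`). If y' ^ N is a positive multiple of y ^ d, then ζ = y ^ (m/N) has
ζ' ^ N > 0, so ζ' keeps a constant direction. Since ζ tends to 0 at the start, it runs along a ray,
and y ^ m = ζ ^ N > 0 puts y on a fixed ray through an m-th root of unity. Unit speed then
determines the parametrization, so the germ of a separatrix is determined by that root.

Sectors (`exists_polar_angle`, `exists_sectors`). G is conformal at 0, so the rays, which are 2π/m
apart, have images leaving a at the same angular distances. Close to a these images are graphs over
the radius in polar coordinates, in unchanged cyclic order. For even N the vectors w and -w
represent the same direction, so reversing time exchanges incoming and outgoing separatrices. -/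

theorem isPreconnected_ball_diff_singleton (a : ℂ) (r : ℝ) :
    IsPreconnected (Metric.ball a r \ {a}) := by
  have h : Metric.ball a r \ {a} =
      (fun p : ℝ × ℝ => a + p.1 * Complex.exp (p.2 * Complex.I)) '' (Ioo 0 r ×ˢ univ) := by
    ext z
    constructor
    · rintro ⟨hz, hza⟩
      refine ⟨(‖z - a‖, Complex.arg (z - a)), ⟨⟨?_, by simpa [dist_eq_norm] using hz⟩, trivial⟩, ?_⟩
      · exact norm_pos_iff.2 (sub_ne_zero.2 hza)
      · simp [Complex.norm_mul_exp_arg_mul_I]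
    · rintro ⟨⟨ρ, θ⟩, ⟨⟨h0, h1⟩, -⟩, rfl⟩
      simp only at h0 h1
      constructor
      · simpa [dist_eq_norm, abs_of_pos h0] using h1
      · simp [h0.ne']
  rw [h]
  apply (isPreconnected_Ioo.prod isPreconnected_univ).image
  fun_prop

theorem hasFDerivAt_re_of_hasDerivAt {F : ℂ → ℂ} {z F' : ℂ} (hF : HasDerivAt F F' z) :
    HasFDerivAt (fun w => (F w).re)
      (Complex.reCLM.comp ((ContinuousLinearMap.toSpanSingleton ℂ F').restrictScalars ℝ)) z :=
  Complex.reCLM.hasFDerivAt.comp z (hF.hasFDerivAt.restrictScalars ℝ)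

/-- The complex partial derivative of a real function is the derivative of any holomorphic function
of which it is the real part. -/
theorem complex_partial_eq_deriv {ψ : ℂ → ℝ} {F : ℂ → ℂ} {z F' : ℂ} (hF : HasDerivAt F F' z)
    (h : ∀ᶠ w in 𝓝 z, (F w).re = ψ w) :
    (fderiv ℝ ψ z 1 : ℂ) - Complex.I * fderiv ℝ ψ z Complex.I = F' := by
  have h2 : HasFDerivAt ψ _ z := (hasFDerivAt_re_of_hasDerivAt hF).congr_of_eventuallyEq
    (h.mono fun _ hw => hw.symm)
  rw [h2.fderiv]
  apply Complex.ext <;> simp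

/-- Only the real part of F is controlled, so Cauchy's estimate is applied to exp(F / δ), with δ =
|z - a|, whose modulus exp(ψ / δ) lies between exp(-C) at z and exp(2C) on the circle of radius δ /
2 around z. The powers of δ cancel, which makes the bound uniform up to a. -/
theorem norm_complex_partial_le {ψ : ℂ → ℝ} {a z : ℂ} {C r : ℝ} (hC : 0 ≤ C)
    (hψ : ∀ z ∈ Metric.ball a r \ {a}, InnerProductSpace.HarmonicAt ψ z)
    (hb : ∀ z ∈ Metric.ball a r \ {a}, |ψ z| ≤ C * ‖z - a‖) (hz : z ≠ a) (hzr : ‖z - a‖ < r / 2) :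
    ‖(fderiv ℝ ψ z 1 : ℂ) - Complex.I * fderiv ℝ ψ z Complex.I‖ ≤ 2 * Real.exp (3 * C) := by
  set δ := ‖z - a‖ with hδ
  have hδ0 : 0 < δ := norm_pos_iff.2 (sub_ne_zero.2 hz)
  have hsub : Metric.ball z δ ⊆ Metric.ball a r \ {a} := by
    intro w hw
    rw [Metric.mem_ball, dist_eq_norm] at hw
    refine ⟨?_, fun h => ?_⟩
    · rw [Metric.mem_ball, dist_eq_norm]
      calc ‖w - a‖ ≤ ‖w - z‖ + ‖z - a‖ := norm_sub_le_norm_sub_add_norm_sub _ _ _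
        _ < r := by linarith
    · rw [mem_singleton_iff] at h
      subst h
      rw [norm_sub_rev] at hw
      exact lt_irrefl _ hw
  obtain ⟨F, hF, hFψ⟩ :=
    InnerProductSpace.HarmonicOnNhd.exists_analyticOnNhd_ball_re_eq
      (f := ψ) (z := z) (R := δ) (fun w hw => hψ w (hsub hw))
  have hF' : ∀ w ∈ Metric.ball z δ, HasDerivAt F (deriv F w) w := fun w hw =>
    (hF w hw).differentiableAt.hasDerivAt
  have hzm : z ∈ Metric.ball z δ := Metric.mem_ball_self hδ0
  rw [complex_partial_eq_deriv (hF' z hzm)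
    (Filter.eventually_of_mem (Metric.isOpen_ball.mem_nhds hzm) hFψ)]
  have hE : ∀ w ∈ Metric.ball z δ, HasDerivAt (fun w => Complex.exp (F w / δ))
      (Complex.exp (F w / δ) * (deriv F w / δ)) w := fun w hw => ((hF' w hw).div_const _).cexp
  have hnorm : ∀ w ∈ Metric.ball z δ, ‖Complex.exp (F w / δ)‖ = Real.exp (ψ w / δ) := by
    intro w hw
    rw [Complex.norm_exp, Complex.div_ofReal_re, ← hFψ hw]
  have hcb : Metric.closedBall z (δ / 2) ⊆ Metric.ball z δ :=
    Metric.closedBall_subset_ball (by linarith)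
  have hcauchy := Complex.norm_deriv_le_of_forall_mem_sphere_norm_le (c := z) (R := δ / 2)
    (C := Real.exp (2 * C)) (f := fun w => Complex.exp (F w / δ)) (by linarith)
    (DifferentiableOn.diffContOnCl_ball (U := Metric.ball z δ)
      (fun w hw => (hE w hw).differentiableAt.differentiableWithinAt) hcb) (by
      intro w hw
      have hw' := hcb (Metric.sphere_subset_closedBall hw)
      rw [hnorm w hw']
      apply Real.exp_le_exp.2
      rw [div_le_iff₀ hδ0]
      refine (le_abs_self _).trans ((hb w (hsub hw')).trans ?_)
      rw [mem_sphere_iff_norm] at hw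
      have : ‖w - a‖ ≤ ‖w - z‖ + ‖z - a‖ := norm_sub_le_norm_sub_add_norm_sub _ _ _
      have : ‖w - a‖ ≤ 2 * δ := by linarith
      nlinarith)
  rw [(hE z hzm).deriv, norm_mul, hnorm z hzm, norm_div, Complex.norm_real, Real.norm_eq_abs,
    abs_of_pos hδ0] at hcauchy
  have hlow : Real.exp (-C) ≤ Real.exp (ψ z / δ) := by
    apply Real.exp_le_exp.2
    rw [le_div_iff₀ hδ0]
    have := (abs_le.1 (hb z (hsub hzm))).1
    linarith
  have h1 : Real.exp (-C) * ‖deriv F z‖ ≤ 2 * Real.exp (2 * C) := by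
    have h2 : Real.exp (-C) * (‖deriv F z‖ / δ) ≤ Real.exp (2 * C) / (δ / 2) :=
      (mul_le_mul_of_nonneg_right hlow (by positivity)).trans hcauchy
    have h3 : Real.exp (-C) * ‖deriv F z‖ = (Real.exp (-C) * (‖deriv F z‖ / δ)) * δ := by
      field_simp
    rw [h3]
    calc _ ≤ Real.exp (2 * C) / (δ / 2) * δ := mul_le_mul_of_nonneg_right h2 hδ0.le
      _ = _ := by field_simp
  have h4 : ‖deriv F z‖ = Real.exp C * (Real.exp (-C) * ‖deriv F z‖) := by
    rw [← mul_assoc, ← Real.exp_add]; simp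
  rw [h4]
  calc _ ≤ Real.exp C * (2 * Real.exp (2 * C)) :=
        mul_le_mul_of_nonneg_left h1 (Real.exp_pos _).le
    _ = 2 * (Real.exp C * Real.exp (2 * C)) := by ring
    _ = _ := by rw [← Real.exp_add]; ring_nf

/-- A harmonic function on a punctured disc that is `O(|z - a|)` is the real part of a holomorphic
function on the whole disc. -/
theorem exists_holomorphic_re_eq_of_harmonic_punctured {ψ : ℂ → ℝ} {a : ℂ} {C r : ℝ} (hC : 0 ≤ C)
    (hr : 0 < r) (hψ : ∀ z ∈ Metric.ball a r \ {a}, InnerProductSpace.HarmonicAt ψ z)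
    (hb : ∀ z ∈ Metric.ball a r \ {a}, |ψ z| ≤ C * ‖z - a‖) :
    ∃ H : ℂ → ℂ, DifferentiableOn ℂ H (Metric.ball a r) ∧
      ∀ z ∈ Metric.ball a r \ {a}, (H z).re = ψ z := by
  set p : ℂ → ℂ := fun z => (fderiv ℝ ψ z 1 : ℂ) - Complex.I * fderiv ℝ ψ z Complex.I with hp
  have hpd : DifferentiableOn ℂ p (Metric.ball a r \ {a}) := fun z hz =>
    (HarmonicAt.differentiableAt_complex_partial (hψ z hz)).differentiableWithinAt
  have hpb : IsBoundedUnder (· ≤ ·) (𝓝[≠] a) (norm ∘ fun z => p z - p a) := by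
    refine ⟨2 * Real.exp (3 * C) + ‖p a‖, ?_⟩
    rw [eventually_map]
    have : Metric.ball a (r / 2) ∈ 𝓝[≠] a :=
      mem_nhdsWithin_of_mem_nhds (Metric.ball_mem_nhds a (by linarith))
    filter_upwards [this, self_mem_nhdsWithin] with z hz hza
    refine (norm_sub_le _ _).trans (add_le_add_left ?_ _)
    exact norm_complex_partial_le hC hψ hb hza (by simpa [dist_eq_norm] using hz)
  -- The singularity of p is removable, so p has a primitive on the full disc and no logarithmic
  -- term can occur.
  have hpo : (fun z => p z - p a) =o[𝓝[≠] a] fun z => (z - a)⁻¹ := hpb.isLittleO_sub_self_inv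
  have hq := Complex.differentiableOn_update_limUnder_of_isLittleO
    (Metric.ball_mem_nhds a hr) hpd hpo
  obtain ⟨H, hH⟩ := hq.isExactOn_ball
  have hopen : IsOpen (Metric.ball a r \ {a}) := Metric.isOpen_ball.sdiff isClosed_singleton
  have hH' : ∀ z ∈ Metric.ball a r \ {a}, HasDerivAt H (p z) z := by
    intro z hz
    have := hH z hz.1
    rwa [Function.update_of_ne hz.2] at this
  have hψd : ∀ z ∈ Metric.ball a r \ {a}, DifferentiableAt ℝ ψ z := fun z hz =>
    (hψ z hz).1.differentiableAt two_ne_zero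
  obtain ⟨c, hc⟩ := hopen.exists_is_const_of_fderiv_eq_zero
    (isPreconnected_ball_diff_singleton a r) (𝕜 := ℝ) (f := fun z => (H z).re - ψ z)
    (fun z hz => ((hasFDerivAt_re_of_hasDerivAt (hH' z hz)).differentiableAt.sub
      (hψd z hz)).differentiableWithinAt) (by
      intro z hz
      rw [((hasFDerivAt_re_of_hasDerivAt (hH' z hz)).fun_sub (hψd z hz).hasFDerivAt).fderiv]
      ext v
      have hv : fderiv ℝ ψ z v = v.re * fderiv ℝ ψ z 1 + v.im * fderiv ℝ ψ z Complex.I := by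
        conv_lhs => rw [show v = v.re • (1 : ℂ) + v.im • Complex.I by simp]
        rw [map_add, map_smul, map_smul, smul_eq_mul, smul_eq_mul]
      simp [hp, hv])
  refine ⟨fun z => H z - c, fun z hz => ((hH z hz).sub_const _).differentiableAt.differentiableWithinAt,
    fun z hz => ?_⟩
  have := hc z hz
  simp only [Complex.sub_re, Complex.ofReal_re]
  linarith

/-! ### The local form of a canonical harmonic map at a singularity -/

theorem div_norm_eq_mul_exp_log_div {x y : ℂ} (hx : x ≠ 0) (hy : y ≠ 0) :
    x / (‖x‖ : ℂ) = y / (‖y‖ : ℂ) * Complex.exp ((Complex.log (x / y)).im * Complex.I) := by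
  have h := Complex.norm_mul_exp_arg_mul_I (x / y)
  rw [Complex.log_im]
  have hx' : (‖x‖ : ℂ) ≠ 0 := by simpa using hx
  have hy' : (‖y‖ : ℂ) ≠ 0 := by simpa using hy
  rw [norm_div, Complex.ofReal_div] at h
  field_simp at h ⊢
  exact h.symm

/-- Division by w - a moves the argument of the logarithm to 1 at z = w, away from the branch cut;
this gives a local angle around a without choosing a global branch. -/
theorem harmonicAt_im_log_div {a w : ℂ} (hw : w ≠ a) :
    InnerProductSpace.HarmonicAt (fun z => (Complex.log ((z - a) / (w - a))).im) w := by
  have h : w - a ≠ 0 := sub_ne_zero.2 hw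
  apply AnalyticAt.harmonicAt_im
  apply AnalyticAt.clog
  · fun_prop (disch := assumption)
  · simp [h]

/-- A continuous determination of the angle of a harmonic circle-valued map, after division by a
power of the direction from `a`, is harmonic. -/
theorem harmonicAt_arg_div {u : ℂ → ℂ} {a w α : ℂ} {e : ℤ} (hα : ‖α‖ = 1) (hw : w ≠ a)
    (hu : IsCircleHarmonicAt u w)
    (hne : ‖u w / (α * ((w - a) / (‖w - a‖ : ℂ)) ^ e) - 1‖ < 1) :
    InnerProductSpace.HarmonicAt
      (fun z => Complex.arg (u z / (α * ((z - a) / (‖z - a‖ : ℂ)) ^ e))) w := by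
  obtain ⟨φ, hφ, hφu⟩ := hu
  set v : ℂ → ℂ := fun z => u z / (α * ((z - a) / (‖z - a‖ : ℂ)) ^ e) with hv
  set θ : ℂ → ℝ := fun z => (Complex.log ((z - a) / (w - a))).im with hθ
  have hα0 : α ≠ 0 := by intro h; simp [h] at hα
  have hwa : w - a ≠ 0 := sub_ne_zero.2 hw
  have hD : (w - a) / (‖w - a‖ : ℂ) ≠ 0 := by simp [hwa]
  have hθw : θ w = 0 := by simp [hθ, hwa]
  -- The constant is chosen so that exp(iχ) = v near w and χ(w) is the principal argument. Since
  -- v(w) is off the cut, χ stays in (-π, π) nearby and must equal arg v there.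
  set χ : ℂ → ℝ := fun z => φ z - e * θ z - (φ w - Complex.arg (v w)) with hχ
  have hχh : InnerProductSpace.HarmonicAt χ w := by
    have h1 := ((hφ.sub ((harmonicAt_im_log_div hw).const_smul (c := (e : ℝ)))).sub
      (InnerProductSpace.harmonicAt_const (φ w - Complex.arg (v w))))
    exact h1
  have hχw : χ w = Complex.arg (v w) := by simp [hχ, hθw]
  have hslit : v w ∈ Complex.slitPlane := by
    have := Complex.mem_slitPlane_of_norm_lt_one hne
    simpa using this
  have hIoo : χ w ∈ Ioo (-Real.pi) Real.pi := by
    rw [hχw]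
    exact ⟨Complex.neg_pi_lt_arg _, lt_of_le_of_ne (Complex.arg_le_pi _)
      (Complex.mem_slitPlane_iff_arg.1 hslit).1⟩
  have huw : u w = Complex.exp (φ w * Complex.I) := hφu.self_of_nhds
  have hvw : Complex.exp (Complex.arg (v w) * Complex.I) = v w := by
    have h1 : ‖v w‖ = 1 := by
      rw [hv]
      simp only [norm_div, norm_mul, norm_zpow, hα, Complex.norm_real, norm_norm]
      rw [div_self (norm_ne_zero_iff.2 hwa), huw, Complex.norm_exp_ofReal_mul_I]
      simp
    have := Complex.norm_mul_exp_arg_mul_I (v w)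
    rwa [h1, Complex.ofReal_one, one_mul] at this
  have hev : ∀ᶠ z in 𝓝 w, χ z = Complex.arg (v z) := by
    have hc : ContinuousAt χ w := hχh.1.continuousAt
    filter_upwards [hφu, hc.eventually (isOpen_Ioo.mem_nhds hIoo),
      isOpen_ne.mem_nhds hw] with z hz hzI hza
    have hza' : z - a ≠ 0 := sub_ne_zero.2 hza
    have hvz : v z = Complex.exp (χ z * Complex.I) := by
      have e1 : Complex.exp (χ z * Complex.I) = Complex.exp (φ z * Complex.I) *
          (Complex.exp (θ z * Complex.I) ^ e)⁻¹ * (Complex.exp (φ w * Complex.I))⁻¹ *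
          Complex.exp (Complex.arg (v w) * Complex.I) := by
        rw [← Complex.exp_int_mul, ← Complex.exp_neg, ← Complex.exp_neg, ← Complex.exp_add,
          ← Complex.exp_add, ← Complex.exp_add]
        congr 1
        simp only [hχ]
        push_cast
        ring
      rw [e1, hvw, ← huw, ← hz]
      have hu0 : u w ≠ 0 := by rw [huw]; exact Complex.exp_ne_zero _
      have hpe : (Complex.exp (θ z * Complex.I)) ^ e ≠ 0 := zpow_ne_zero _ (Complex.exp_ne_zero _)
      have hDe := zpow_ne_zero e hD
      simp only [hv]
      rw [div_norm_eq_mul_exp_log_div hza' hwa, mul_zpow,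
        show (Complex.log ((z - a) / (w - a))).im = θ z from rfl]
      field_simp
    rw [hvz, Complex.arg_exp_mul_I]
    exact ((toIocMod_eq_self _).2 ⟨hzI.1, by linarith [hzI.2]⟩).symm
  exact (InnerProductSpace.harmonicAt_congr_nhds hev).1 hχh

/-- The quotient v of u by its leading term satisfies |v - 1| = O(|z - a|), so arg v is harmonic,
single-valued and O(|z - a|). The removable singularity theorem makes it Re H; the phase of α is
absorbed into H as a constant. -/
theorem exists_local_form {u : ℂ → ℂ} {a α : ℂ} {e : ℤ} {C : ℝ} (hα : ‖α‖ = 1)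
    (hu : ∀ᶠ z in 𝓝[≠] a, IsCircleHarmonicAt u z)
    (hest : ∀ᶠ z in 𝓝[≠] a, ‖u z - α * ((z - a) ^ e / (‖z - a‖ : ℂ) ^ e)‖ ≤ C * ‖z - a‖) :
    ∃ r > 0, ∃ H : ℂ → ℂ, DifferentiableOn ℂ H (Metric.ball a r) ∧
      ∀ z ∈ Metric.ball a r \ {a},
        u z = Complex.exp ((H z).re * Complex.I) * ((z - a) / (‖z - a‖ : ℂ)) ^ e := by
  have hα0 : α ≠ 0 := by intro h; simp [h] at hα
  set v : ℂ → ℂ := fun z => u z / (α * ((z - a) / (‖z - a‖ : ℂ)) ^ e) with hv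
  set C' : ℝ := |C| + 1 with hC'
  have hC'0 : 0 < C' := by positivity
  obtain ⟨r₀, hr₀, hr₀'⟩ := Metric.mem_nhdsWithin_iff.1 (hu.and hest)
  -- This radius gives |v - 1| ≤ 1/2, the range in which |log v| ≤ (3/2) |v - 1|.
  set r := min r₀ (1 / (2 * C')) with hr
  have hr0 : 0 < r := by positivity
  have key : ∀ z ∈ Metric.ball a r \ {a}, IsCircleHarmonicAt u z ∧ ‖v z - 1‖ ≤ C' * ‖z - a‖ ∧
      ‖v z - 1‖ ≤ 1 / 2 := by
    rintro z ⟨hz, hza⟩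
    obtain ⟨h1, h2⟩ := hr₀' ⟨Metric.ball_subset_ball (min_le_left _ _) hz, hza⟩
    have hza' : z - a ≠ 0 := sub_ne_zero.2 hza
    have hDn : ‖α * ((z - a) / (‖z - a‖ : ℂ)) ^ e‖ = 1 := by
      simp only [norm_mul, norm_zpow, hα, norm_div, Complex.norm_real, norm_norm]
      rw [div_self (norm_ne_zero_iff.2 hza')]; simp
    have hD0 : α * ((z - a) / (‖z - a‖ : ℂ)) ^ e ≠ 0 := by
      intro h; rw [h] at hDn; simp at hDn
    have h3 : ‖v z - 1‖ = ‖u z - α * ((z - a) ^ e / (‖z - a‖ : ℂ) ^ e)‖ := by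
      rw [← div_zpow, hv]
      simp only
      rw [div_sub_one hD0, norm_div, hDn, div_one]
    have h4 : ‖v z - 1‖ ≤ C' * ‖z - a‖ := by
      rw [h3]
      refine h2.trans (mul_le_mul_of_nonneg_right ?_ (norm_nonneg _))
      linarith [le_abs_self C]
    refine ⟨h1, h4, h4.trans ?_⟩
    have h5 : ‖z - a‖ < 1 / (2 * C') := by
      rw [Metric.mem_ball, dist_eq_norm] at hz
      exact hz.trans_le (min_le_right _ _)
    calc C' * ‖z - a‖ ≤ C' * (1 / (2 * C')) := mul_le_mul_of_nonneg_left h5.le hC'0.le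
      _ = 1 / 2 := by field_simp
  obtain ⟨H, hH, hHψ⟩ := exists_holomorphic_re_eq_of_harmonic_punctured
    (ψ := fun z => Complex.arg (v z)) (a := a) (C := 3 / 2 * C') (r := r) (by positivity) hr0
    (fun z hz => harmonicAt_arg_div hα hz.2 (key z hz).1 ((key z hz).2.2.trans_lt (by norm_num)))
    (by
      intro z hz
      rw [← Complex.log_im]
      refine (Complex.abs_im_le_norm _).trans ?_
      have h := Complex.norm_log_one_add_half_le_self (key z hz).2.2
      rw [add_sub_cancel] at h
      refine h.trans ?_
      have := (key z hz).2.1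
      linarith)
  refine ⟨r, hr0, fun z => H z + Complex.arg α, hH.add_const _, fun z hz => ?_⟩
  have hza' : z - a ≠ 0 := sub_ne_zero.2 hz.2
  obtain ⟨φ, -, hφ⟩ := (key z hz).1
  have hvn : ‖v z‖ = 1 := by
    simp only [hv, norm_mul, norm_zpow, hα, norm_div, Complex.norm_real, norm_norm]
    rw [div_self (norm_ne_zero_iff.2 hza'), hφ.self_of_nhds, Complex.norm_exp_ofReal_mul_I]; simp
  have h1 := Complex.norm_mul_exp_arg_mul_I (v z)
  have h2 := Complex.norm_mul_exp_arg_mul_I α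
  rw [hvn, Complex.ofReal_one, one_mul] at h1
  rw [hα, Complex.ofReal_one, one_mul] at h2
  rw [Complex.add_re, Complex.ofReal_re, hHψ z hz, Complex.ofReal_add, add_mul, Complex.exp_add, h1,
    h2]
  have hD0 : ((z - a) / (‖z - a‖ : ℂ)) ^ e ≠ 0 := zpow_ne_zero _ (by simp [hza'])
  simp only [hv]
  field_simp

/-- The exponent of the leading term at a singularity is the winding number of the map. -/
theorem winding_eq_exponent {u : ℂ → ℂ} {a : ℂ} {e d : ℤ} {α : ℂ} {C : ℝ} (hα : ‖α‖ = 1)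
    (hest : ∀ᶠ z in 𝓝[≠] a, ‖u z - α * ((z - a) ^ e / (‖z - a‖ : ℂ) ^ e)‖ ≤ C * ‖z - a‖)
    (hidx : ∀ᶠ r : ℝ in 𝓝[>] 0, ∃ ϑ : ℝ → ℝ, ContinuousOn ϑ (Icc 0 1) ∧
      (∀ t ∈ Icc (0 : ℝ) 1, u (a + r * Complex.exp (2 * Real.pi * t * Complex.I)) =
        Complex.exp (ϑ t * Complex.I)) ∧ ϑ 1 - ϑ 0 = 2 * Real.pi * d) : d = e := by
  obtain ⟨r₀, hr₀, hr₀'⟩ := Metric.mem_nhdsWithin_iff.1 hest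
  have hr1 : ∀ᶠ r : ℝ in 𝓝[>] 0, r < min r₀ (1 / (|C| + 1)) :=
    (eventually_lt_nhds (by positivity)).filter_mono nhdsWithin_le_nhds
  obtain ⟨r, ⟨⟨ϑ, hϑc, hϑu, hϑd⟩, hrlt⟩, hr0⟩ :=
    ((hidx.and hr1).and (eventually_mem_nhdsWithin (a := (0 : ℝ)) (s := Ioi 0))).exists
  rw [mem_Ioi] at hr0
  have hCr : C * r < 1 := by
    have h1 : r < 1 / (|C| + 1) := hrlt.trans_le (min_le_right _ _)
    rw [lt_div_iff₀ (by positivity)] at h1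
    nlinarith [le_abs_self C]
  have hα2 := Complex.norm_mul_exp_arg_mul_I α
  rw [hα, Complex.ofReal_one, one_mul] at hα2
  -- The phase of u relative to its leading term. As exp(is) stays within distance less than 1 of 1,
  -- s can never cross an odd multiple of π, whereas for d ≠ e it would change by at least 2π.
  set s : ℝ → ℝ := fun t => ϑ t - 2 * Real.pi * e * t - Complex.arg α with hs
  have hsc : ContinuousOn s (Icc 0 1) := by
    apply ContinuousOn.sub _ continuousOn_const
    exact hϑc.sub (by fun_prop)
  have hsn : ∀ t ∈ Icc (0 : ℝ) 1, ‖Complex.exp (s t * Complex.I) - 1‖ < 1 := by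
    intro t ht
    set E := Complex.exp (2 * Real.pi * t * Complex.I) with hE
    have hEn : ‖E‖ = 1 := by
      rw [hE, show (2 * Real.pi * t * Complex.I : ℂ) = ((2 * Real.pi * t : ℝ) : ℂ) * Complex.I by
        push_cast; ring]
      exact Complex.norm_exp_ofReal_mul_I _
    have hzn : ‖a + r * E - a‖ = r := by
      rw [add_sub_cancel_left, norm_mul, hEn, Complex.norm_real, Real.norm_eq_abs, abs_of_pos hr0,
        mul_one]
    have h1 : ‖u (a + r * E) - α * ((a + r * E - a) ^ e / (‖a + r * E - a‖ : ℂ) ^ e)‖ ≤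
        C * ‖a + r * E - a‖ := by
      apply hr₀'
      refine ⟨?_, ?_⟩
      · rw [Metric.mem_ball, dist_eq_norm, hzn]
        exact hrlt.trans_le (min_le_left _ _)
      · intro h
        rw [mem_singleton_iff] at h
        rw [h, sub_self, norm_zero] at hzn
        exact hr0.ne hzn
    rw [hzn, hϑu t ht, add_sub_cancel_left, ← div_zpow] at h1
    have hrc : (r : ℂ) ≠ 0 := by exact_mod_cast hr0.ne'
    rw [mul_div_cancel_left₀ _ hrc] at h1
    have h2 : Complex.exp (ϑ t * Complex.I) = α * E ^ e * Complex.exp (s t * Complex.I) := by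
      conv_rhs => rw [← hα2]
      rw [hE, ← Complex.exp_int_mul, ← Complex.exp_add, ← Complex.exp_add]
      congr 1
      simp only [hs]
      push_cast
      ring
    have h3 : ‖α * E ^ e‖ = 1 := by rw [norm_mul, norm_zpow, hα, hEn]; simp
    rw [h2, ← mul_sub_one, norm_mul, h3, one_mul] at h1
    exact h1.trans_lt hCr
  by_contra hde
  have hs10 : s 1 - s 0 = 2 * Real.pi * (d - e) := by
    simp only [hs]
    linarith
  have hlen : 2 * Real.pi ≤ |s 1 - s 0| := by
    rw [hs10, abs_mul, abs_of_pos Real.two_pi_pos]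
    have : (1 : ℝ) ≤ |((d : ℝ) - e)| := by
      have : 1 ≤ |d - e| := Int.one_le_abs (sub_ne_zero.2 hde)
      exact_mod_cast this
    nlinarith [Real.two_pi_pos]
  -- The least n with π + 2πn not below the range of endpoint values; a range of length at least 2π
  -- contains this number.
  set n : ℤ := ⌈(min (s 0) (s 1) - Real.pi) / (2 * Real.pi)⌉ with hn
  have hc : Real.pi + 2 * Real.pi * n ∈ uIcc (s 0) (s 1) := by
    have h1 := Int.le_ceil ((min (s 0) (s 1) - Real.pi) / (2 * Real.pi))
    have h2 := Int.ceil_lt_add_one ((min (s 0) (s 1) - Real.pi) / (2 * Real.pi))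
    rw [← hn, div_le_iff₀ Real.two_pi_pos] at h1
    rw [← hn, ← sub_lt_iff_lt_add, lt_div_iff₀ Real.two_pi_pos] at h2
    constructor
    · linarith
    · have : max (s 0) (s 1) - min (s 0) (s 1) = |s 1 - s 0| := max_sub_min_eq_abs' _ _ |>.trans
        (abs_sub_comm _ _)
      linarith
  have hIVT := intermediate_value_uIcc (f := s) (a := 0) (b := 1)
    (by rwa [uIcc_of_le zero_le_one])
  obtain ⟨t, ht, hst⟩ := hIVT hc
  rw [uIcc_of_le zero_le_one] at ht
  have h := hsn t ht
  rw [hst] at h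
  have : Complex.exp ((Real.pi + 2 * Real.pi * n : ℝ) * Complex.I) = -1 := by
    rw [show (((Real.pi + 2 * Real.pi * n : ℝ) : ℂ) * Complex.I) =
      Real.pi * Complex.I + n * (2 * Real.pi * Complex.I) by push_cast; ring, Complex.exp_add,
      Complex.exp_pi_mul_I, Complex.exp_int_mul_two_pi_mul_I, mul_one]
  rw [this] at h
  norm_num at h

/-! ### The natural coordinate at a singularity -/

/-- The solution is K(z) = ∫₀¹ t ^ (m - 1) k(t ^ N z) dt: the integrand of m K + N z K' is the
t-derivative of t ^ m k(t ^ N z), which is k(z) at t = 1 and vanishes at t = 0 because m ≥ 1. -/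
theorem exists_euler_equation_solution {k : ℂ → ℂ} {r : ℝ}
    (hk : DifferentiableOn ℂ k (Metric.ball 0 r)) {N m : ℕ} (hN : 1 ≤ N) (hm : 1 ≤ m) :
    ∃ K K' : ℂ → ℂ, ∀ z ∈ Metric.ball (0 : ℂ) r,
      HasDerivAt K (K' z) z ∧ m * K z + N * z * K' z = k z := by
  have hk' : ∀ z ∈ Metric.ball (0 : ℂ) r, HasDerivAt k (deriv k z) z := fun z hz =>
    (hk.differentiableAt (Metric.isOpen_ball.mem_nhds hz)).hasDerivAt
  have hdk : ContinuousOn (deriv k) (Metric.ball 0 r) :=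
    (hk.deriv Metric.isOpen_ball).continuousOn
  have hmaps : ∀ (s : ℝ) (z : ℂ), ‖z‖ ≤ s → ∀ t ∈ Icc (0 : ℝ) 1,
      (t : ℂ) ^ N * z ∈ Metric.closedBall (0 : ℂ) s := by
    intro s z hz t ht
    rw [mem_closedBall_zero_iff, norm_mul, norm_pow, Complex.norm_real, Real.norm_eq_abs,
      abs_of_nonneg ht.1]
    calc t ^ N * ‖z‖ ≤ 1 * ‖z‖ :=
          mul_le_mul_of_nonneg_right (pow_le_one₀ ht.1 ht.2) (norm_nonneg _)
      _ ≤ s := by rwa [one_mul]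
  have hmapsr : ∀ z ∈ Metric.ball (0 : ℂ) r, ∀ t ∈ Icc (0 : ℝ) 1,
      (t : ℂ) ^ N * z ∈ Metric.ball (0 : ℂ) r := by
    intro z hz t ht
    exact Metric.closedBall_subset_ball (mem_ball_zero_iff.1 hz) (hmaps _ z le_rfl t ht)
  set F : ℂ → ℝ → ℂ := fun z t => (t : ℂ) ^ (m - 1) * k ((t : ℂ) ^ N * z) with hF
  set F' : ℂ → ℝ → ℂ := fun z t => (t : ℂ) ^ (m - 1) * (deriv k ((t : ℂ) ^ N * z) * (t : ℂ) ^ N)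
    with hF'
  have hFc : ∀ z ∈ Metric.ball (0 : ℂ) r, ContinuousOn (F z) (Icc 0 1) := by
    intro z hz
    apply ContinuousOn.mul (by fun_prop)
    exact hk.continuousOn.comp (by fun_prop) (fun t ht => hmapsr z hz t ht)
  have hFc' : ∀ z ∈ Metric.ball (0 : ℂ) r, ContinuousOn (F' z) (Icc 0 1) := by
    intro z hz
    apply ContinuousOn.mul (by fun_prop)
    apply ContinuousOn.mul _ (by fun_prop)
    exact hdk.comp (by fun_prop) (fun t ht => hmapsr z hz t ht)
  have huIoc : uIoc (0 : ℝ) 1 ⊆ Icc 0 1 := by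
    rw [uIoc_of_le zero_le_one]; exact Ioc_subset_Icc_self
  have hderiv : ∀ z ∈ Metric.ball (0 : ℂ) r, ∀ t ∈ Icc (0 : ℝ) 1,
      HasDerivAt (fun z => F z t) (F' z t) z := by
    intro z hz t ht
    apply HasDerivAt.const_mul
    have h1 : HasDerivAt (fun z : ℂ => (t : ℂ) ^ N * z) ((t : ℂ) ^ N) z := by
      simpa using (hasDerivAt_id z).const_mul ((t : ℂ) ^ N)
    exact (hk' _ (hmapsr z hz t ht)).comp z h1
  refine ⟨fun z => ∫ t in (0 : ℝ)..1, F z t, fun z => ∫ t in (0 : ℝ)..1, F' z t, fun z hz => ?_⟩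
  have hzr : ‖z‖ < r := mem_ball_zero_iff.1 hz
  obtain ⟨s, hzs, hsr⟩ := exists_between hzr
  have hcb : Metric.closedBall (0 : ℂ) s ⊆ Metric.ball 0 r := Metric.closedBall_subset_ball hsr
  obtain ⟨B, hB⟩ := (isCompact_closedBall (0 : ℂ) s).exists_bound_of_continuousOn (hdk.mono hcb)
  have hint : IntervalIntegrable (F z) MeasureTheory.volume 0 1 :=
    ContinuousOn.intervalIntegrable (by rw [uIcc_of_le zero_le_one]; exact hFc z hz)
  have hint' : IntervalIntegrable (F' z) MeasureTheory.volume 0 1 :=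
    ContinuousOn.intervalIntegrable (by rw [uIcc_of_le zero_le_one]; exact hFc' z hz)
  constructor
  · refine (intervalIntegral.hasDerivAt_integral_of_dominated_loc_of_deriv_le
      (F := F) (F' := F') (bound := fun _ => B) (s := Metric.ball 0 s)
      (Metric.isOpen_ball.mem_nhds (mem_ball_zero_iff.2 hzs)) ?_ hint ?_ ?_ (by simp) ?_).2
    · filter_upwards [Metric.isOpen_ball.mem_nhds hz] with w hw
      exact ((hFc w hw).mono huIoc).aestronglyMeasurable measurableSet_uIoc
    · exact ((hFc' z hz).mono huIoc).aestronglyMeasurable measurableSet_uIoc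
    · refine Filter.Eventually.of_forall fun t ht w hw => ?_
      have ht' := huIoc ht
      have hb := hB _ (hmaps s w (mem_ball_zero_iff.1 hw).le t ht')
      have h1 : ∀ n : ℕ, ‖(t : ℂ) ^ n‖ ≤ 1 := by
        intro n
        rw [norm_pow, Complex.norm_real, Real.norm_eq_abs, abs_of_nonneg ht'.1]
        exact pow_le_one₀ ht'.1 ht'.2
      have hB0 : 0 ≤ B := (norm_nonneg _).trans hb
      simp only [hF', norm_mul]
      calc _ ≤ 1 * (B * 1) := by
            gcongr
            · exact h1 _
            · exact h1 _
        _ = B := by ring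
    · refine Filter.Eventually.of_forall fun t ht w hw => ?_
      exact hderiv w (hcb (Metric.ball_subset_closedBall hw)) t (huIoc ht)
  · have hftc : ∫ t in (0 : ℝ)..1, (m * F z t + N * z * F' z t) =
        (1 : ℝ) ^ m * k ((1 : ℝ) ^ N * z) - (0 : ℝ) ^ m * k ((0 : ℝ) ^ N * z) := by
      have := intervalIntegral.integral_eq_sub_of_hasDerivAt (a := 0) (b := 1)
        (f := fun t : ℝ => (t : ℂ) ^ m * k ((t : ℂ) ^ N * z))
        (f' := fun t => m * F z t + N * z * F' z t) ?_ ?_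
      · simpa using this
      · intro t ht
        rw [uIcc_of_le zero_le_one] at ht
        have h1 : ∀ n : ℕ, HasDerivAt (fun t : ℝ => (t : ℂ) ^ n) (n * (t : ℂ) ^ (n - 1)) t := by
          intro n
          exact (hasDerivAt_pow n (t : ℂ)).comp_ofReal
        have h2 := (h1 m).mul ((hk' _ (hmapsr z hz t ht)).comp t ((h1 N).mul_const z))
        refine h2.congr_deriv ?_
        simp only [hF, hF', Function.comp]
        obtain ⟨m', rfl⟩ := Nat.exists_eq_add_of_le' hm
        obtain ⟨N', rfl⟩ := Nat.exists_eq_add_of_le' hN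
        simp only [Nat.add_sub_cancel]
        push_cast
        ring
      · exact (hint.const_mul _).add (hint'.const_mul _)
    rw [intervalIntegral.integral_add (hint.const_mul _) (hint'.const_mul _),
      intervalIntegral.integral_const_mul, intervalIntegral.integral_const_mul] at hftc
    rw [hftc]
    have : m ≠ 0 := by omega
    simp [this]

/-- A unit vector field `exp (i Re H) (z / |z|) ^ d` is, up to positive factors, the model field
`W ^ d` in a suitable holomorphic coordinate `W`. -/
theorem exists_natural_coordinate {H : ℂ → ℂ} {r : ℝ} (hr : 0 < r)
    (hH : DifferentiableOn ℂ H (Metric.ball 0 r)) {N m : ℕ} {d : ℤ} (hN : 1 ≤ N) (hm : 1 ≤ m)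
    (hd : (m : ℤ) + d = N) :
    ∃ W : ℂ → ℂ, AnalyticAt ℂ W 0 ∧ W 0 = 0 ∧ deriv W 0 ≠ 0 ∧ ∀ᶠ z in 𝓝 0, z ≠ 0 → ∃ c : ℝ, 0 < c ∧
      Complex.exp ((H z).re * Complex.I) * (z / (‖z‖ : ℂ)) ^ d * deriv W z ^ N = c * W z ^ d := by
  -- Its N-th power exp(-iH) cancels the phase exp(i Re H) and leaves the positive factor exp(Im H).
  set k : ℂ → ℂ := fun z => Complex.exp (-(H z * Complex.I) / N) with hk
  have hkd : DifferentiableOn ℂ k (Metric.ball 0 r) :=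
    ((hH.mul_const Complex.I).neg.div_const _).cexp
  obtain ⟨K, K', hK⟩ := exists_euler_equation_solution hkd hN hm
  have hm0 : (m : ℂ) ≠ 0 := by exact_mod_cast (by omega : m ≠ 0)
  have hN0 : (N : ℂ) ≠ 0 := by exact_mod_cast (by omega : N ≠ 0)
  have h0r : (0 : ℂ) ∈ Metric.ball (0 : ℂ) r := Metric.mem_ball_self hr
  have hK0 : K 0 ≠ 0 := by
    intro h
    have := (hK 0 h0r).2
    rw [h, hk] at this
    simp only [mul_zero, zero_mul, add_zero] at this
    exact (Complex.exp_ne_zero _) this.symm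
  -- A branch of log(K ^ (N/m)) near 0. K 0 is split off since it may lie on the cut of the
  -- logarithm. The Euler equation then simplifies the derivative of z exp(l) to exp(l) k / (m K).
  set l : ℂ → ℂ := fun z => (N / m : ℂ) * (Complex.log (K z / K 0) + Complex.log (K 0)) with hl
  have hslit : ∀ᶠ z in 𝓝 (0 : ℂ), K z / K 0 ∈ Complex.slitPlane := by
    have hc : ContinuousAt (fun z => K z / K 0) 0 := (hK 0 h0r).1.continuousAt.div_const _
    apply hc.eventually (Complex.isOpen_slitPlane.mem_nhds _)
    simp [hK0]
  have hgood : ∀ᶠ z in 𝓝 (0 : ℂ), z ∈ Metric.ball (0 : ℂ) r ∧ K z / K 0 ∈ Complex.slitPlane :=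
    (Metric.isOpen_ball.eventually_mem h0r).and hslit
  set W : ℂ → ℂ := fun z => z * Complex.exp (l z) with hW
  have hKne : ∀ z, K z / K 0 ∈ Complex.slitPlane → K z ≠ 0 := by
    intro z hz h
    rw [h, zero_div] at hz
    exact Complex.slitPlane_ne_zero hz rfl
  have hWd : ∀ z, z ∈ Metric.ball (0 : ℂ) r ∧ K z / K 0 ∈ Complex.slitPlane →
      HasDerivAt W (Complex.exp (l z) * k z / (m * K z)) z := by
    rintro z ⟨hz, hzs⟩
    have h1 := ((((hK z hz).1.div_const (K 0)).clog hzs).add_const (Complex.log (K 0))).const_mul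
      (N / m : ℂ)
    have h2 := (hasDerivAt_id' z).fun_mul h1.cexp
    refine h2.congr_deriv ?_
    have hKz := hKne z hzs
    rw [← (hK z hz).2]
    simp only [hl]
    field_simp
  refine ⟨W, ?_, by simp [hW], ?_, ?_⟩
  · rw [Complex.analyticAt_iff_eventually_differentiableAt]
    exact hgood.mono fun z hz => (hWd z hz).differentiableAt
  · rw [(hWd 0 hgood.self_of_nhds).deriv]
    exact div_ne_zero (mul_ne_zero (Complex.exp_ne_zero _) (Complex.exp_ne_zero _))
      (mul_ne_zero hm0 hK0)
  · filter_upwards [hgood] with z hz hz0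
    have hKz := hKne z hz.2
    have hzn : 0 < ‖z‖ := norm_pos_iff.2 hz0
    have hpow : Complex.exp (l z) ^ m = K z ^ N := by
      rw [← Complex.exp_nat_mul]
      have : (m : ℂ) * l z = N * (Complex.log (K z / K 0) + Complex.log (K 0)) := by
        simp only [hl]; field_simp
      rw [this, Complex.exp_nat_mul, Complex.exp_add, Complex.exp_log (div_ne_zero hKz hK0),
        Complex.exp_log hK0, div_mul_cancel₀ _ hK0]
    have hkN : k z ^ N = Complex.exp (-(H z * Complex.I)) := by
      simp only [hk]
      rw [← Complex.exp_nat_mul]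
      congr 1
      field_simp
    have hEN : Complex.exp (l z) ^ N = Complex.exp (l z) ^ d * K z ^ N := by
      rw [← hpow, ← zpow_natCast, ← zpow_natCast, ← zpow_add₀ (Complex.exp_ne_zero _), ← hd,
        add_comm]
    refine ⟨Real.exp ((H z).im) * (‖z‖ ^ d)⁻¹ * ((m : ℝ) ^ N)⁻¹, by positivity, ?_⟩
    rw [(hWd z hz).deriv, div_pow, mul_pow, mul_pow, hEN, hkN, div_zpow]
    simp only [hW]
    rw [mul_zpow]
    have hexp : Complex.exp ((H z).re * Complex.I) * Complex.exp (-(H z * Complex.I)) =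
        (Real.exp (H z).im : ℂ) := by
      rw [← Complex.exp_add, Complex.ofReal_exp]
      congr 1
      linear_combination Complex.I * Complex.re_add_im (H z) - ((H z).im : ℂ) * Complex.I_sq
    push_cast
    rw [← Complex.ofReal_exp, ← hexp]
    have hKN := pow_ne_zero N hKz
    field_simp

/-- `G`, with inverse `V`, is a holomorphic parametrization of a neighborhood of `a` in which the
field `u` is, up to positive factors, the pullback of the model field `y ^ d`. -/
structure IsNaturalChart (N : ℕ) (d : ℤ) (u : ℂ → ℂ) (a : ℂ) (ρ : ℝ) (G V : ℂ → ℂ) : Prop where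
  pos : 0 < ρ
  map_zero : G 0 = a
  differentiableOn : DifferentiableOn ℂ G (Metric.ball 0 ρ)
  deriv_ne_zero : ∀ y ∈ Metric.ball (0 : ℂ) ρ, deriv G y ≠ 0
  left_inv : ∀ y ∈ Metric.ball (0 : ℂ) ρ, V (G y) = y
  right_inv : ∀ᶠ z in 𝓝 a, V z ∈ Metric.ball (0 : ℂ) ρ ∧ G (V z) = z ∧
    HasDerivAt V (deriv G (V z))⁻¹ z
  field : ∀ y ∈ Metric.ball (0 : ℂ) ρ, y ≠ 0 →
    ∃ c : ℝ, 0 < c ∧ u (G y) = c * deriv G y ^ N * y ^ d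

/-- The inverse function theorem for z ↦ W(z - a): V is this map and G its local inverse. Since G' =
1 / V', the relation u V' ^ N = c V ^ d becomes u(G y) = c G'(y) ^ N y ^ d. -/
theorem exists_isNaturalChart {N m : ℕ} {d : ℤ} (hN : 1 ≤ N) (hm : 1 ≤ m) (hd : (m : ℤ) + d = N)
    {u : ℂ → ℂ} {a : ℂ} {r : ℝ} (hr : 0 < r) {H : ℂ → ℂ}
    (hH : DifferentiableOn ℂ H (Metric.ball a r))
    (hu : ∀ z ∈ Metric.ball a r \ {a},
        u z = Complex.exp ((H z).re * Complex.I) * ((z - a) / (‖z - a‖ : ℂ)) ^ d)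
    {U : Set ℂ} (hU : U ∈ 𝓝 a) :
    ∃ ρ G V, IsNaturalChart N d u a ρ G V ∧ ∀ y ∈ Metric.ball (0 : ℂ) ρ, G y ∈ U := by
  obtain ⟨W, hWa, hW0, hW', hWu⟩ := exists_natural_coordinate (H := fun z => H (a + z)) hr
    (hH.comp (by fun_prop) (fun z hz => by simpa using hz)) hN hm hd
  set P : ℂ → ℂ := fun z => W (z - a) with hP
  have hPd : ∀ᶠ z in 𝓝 a, AnalyticAt ℂ P z := by
    have h1 : Tendsto (fun z => z - a) (𝓝 a) (𝓝 0) := by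
      have : ContinuousAt (fun z => z - a) a := by fun_prop
      simpa [ContinuousAt] using this
    filter_upwards [h1.eventually hWa.eventually_analyticAt] with z hz
    exact hz.comp (f := fun z => z - a) (by fun_prop)
  have hPderiv : ∀ z, deriv P z = deriv W (z - a) := fun z => deriv_comp_sub_const ..
  have hPa : P a = 0 := by simp [hP, hW0]
  have hPa' : deriv P a ≠ 0 := by rw [hPderiv, sub_self]; exact hW'
  have hPs : HasStrictDerivAt P (deriv P a) a := hPd.self_of_nhds.hasStrictDerivAt
  set E := (hPs.hasStrictFDerivAt_equiv hPa').toOpenPartialHomeomorph P with hE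
  have hEP : ∀ z, E z = P z := fun z => rfl
  have haE : a ∈ E.source := HasStrictFDerivAt.mem_toOpenPartialHomeomorph_source _
  have h0E : (0 : ℂ) ∈ E.target := by
    rw [← hPa, ← hEP]; exact E.map_source haE
  have hE0 : E.symm 0 = a := by rw [← hPa, ← hEP]; exact E.left_inv haE
  have hPd' : ∀ᶠ z in 𝓝 a, deriv P z ≠ 0 :=
    hPd.self_of_nhds.deriv.continuousAt.eventually_ne hPa'
  have hfield : ∀ᶠ z in 𝓝 a, z ≠ a → ∃ c : ℝ, 0 < c ∧ u z * deriv P z ^ N = c * P z ^ d := by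
    have h1 : Tendsto (fun z => z - a) (𝓝 a) (𝓝 0) := by
      have : ContinuousAt (fun z => z - a) a := by fun_prop
      simpa [ContinuousAt] using this
    filter_upwards [h1.eventually hWu, Metric.ball_mem_nhds a hr] with z hz hzr hza
    obtain ⟨c, hc, h⟩ := hz (sub_ne_zero.2 hza)
    refine ⟨c, hc, ?_⟩
    rw [hu z ⟨hzr, hza⟩, hPderiv]
    simpa using h
  have hO : ∀ᶠ z in 𝓝 a, AnalyticAt ℂ P z ∧ deriv P z ≠ 0 ∧
      (z ≠ a → ∃ c : ℝ, 0 < c ∧ u z * deriv P z ^ N = c * P z ^ d) ∧ z ∈ U :=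
    hPd.and (hPd'.and (hfield.and hU))
  have hsymm : Tendsto E.symm (𝓝 0) (𝓝 a) := by
    have := E.symm.continuousAt (x := 0) h0E
    rwa [ContinuousAt, hE0] at this
  obtain ⟨ρ, hρ, hball⟩ := Metric.eventually_nhds_iff_ball.1
    ((hsymm.eventually hO).and (E.open_target.eventually_mem h0E))
  have hG : ∀ y ∈ Metric.ball (0 : ℂ) ρ, HasDerivAt E.symm (deriv P (E.symm y))⁻¹ y := by
    intro y hy
    obtain ⟨⟨h1, h2, -⟩, h3⟩ := hball y hy
    exact E.hasDerivAt_symm h3 h2 h1.differentiableAt.hasDerivAt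
  have hPE : ∀ y ∈ Metric.ball (0 : ℂ) ρ, P (E.symm y) = y := fun y hy =>
    E.right_inv (hball y hy).2
  refine ⟨ρ, E.symm, P, ⟨hρ, hE0, fun y hy => (hG y hy).differentiableAt.differentiableWithinAt,
    fun y hy => ?_, hPE, ?_, fun y hy hy0 => ?_⟩, fun y hy => (hball y hy).1.2.2.2⟩
  · rw [(hG y hy).deriv]
    exact inv_ne_zero (hball y hy).1.2.1
  · have hPc : ContinuousAt P a := hPd.self_of_nhds.continuousAt
    have : ∀ᶠ z in 𝓝 a, P z ∈ Metric.ball (0 : ℂ) ρ :=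
      hPc.eventually (Metric.isOpen_ball.mem_nhds (by rw [hPa]; exact Metric.mem_ball_self hρ))
    filter_upwards [this, E.open_source.mem_nhds haE, hPd] with z hz hzs hzd
    have hz' : E.symm (P z) = z := E.left_inv hzs
    refine ⟨hz, hz', ?_⟩
    rw [(hG _ hz).deriv, hz', inv_inv]
    exact hzd.differentiableAt.hasDerivAt
  · have hne : E.symm y ≠ a := by
      intro h
      have := hPE y hy
      rw [h, hPa] at this
      exact hy0 this.symm
    obtain ⟨⟨-, h2, h3, -⟩, -⟩ := hball y hy
    obtain ⟨c, hc, h⟩ := h3 hne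
    refine ⟨c, hc, ?_⟩
    rw [hPE y hy] at h
    rw [(hG y hy).deriv, inv_pow]
    have := pow_ne_zero N h2
    field_simp
    exact h

/-! ### Real one-variable calculus -/

theorem hasDerivAt_integral_of_continuousOn_Ioo {E : Type*} [NormedAddCommGroup E]
    [NormedSpace ℝ E] [CompleteSpace E] {f : ℝ → E} {s t x₀ x : ℝ} (hf : ContinuousOn f (Ioo s t))
    (hx₀ : x₀ ∈ Ioo s t) (hx : x ∈ Ioo s t) :
    HasDerivAt (fun x => ∫ τ in x₀..x, f τ) (f x) x := by
  apply intervalIntegral.integral_hasDerivAt_right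
  · exact (hf.mono (ordConnected_Ioo.uIcc_subset hx₀ hx)).intervalIntegrable
  · exact hf.stronglyMeasurableAtFilter isOpen_Ioo x hx
  · exact hf.continuousAt (isOpen_Ioo.mem_nhds hx)

theorem eq_of_hasDerivAt_zero_Ioo {E : Type*} [NormedAddCommGroup E] [NormedSpace ℝ E]
    {f : ℝ → E} {s t x y : ℝ} (hf : ∀ τ ∈ Ioo s t, HasDerivAt f 0 τ) (hx : x ∈ Ioo s t)
    (hy : y ∈ Ioo s t) : f x = f y := by
  apply isOpen_Ioo.is_const_of_fderiv_eq_zero (𝕜 := ℝ) isPreconnected_Ioo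
    (fun τ hτ => (hf τ hτ).differentiableAt.differentiableWithinAt) _ hx hy
  intro τ hτ
  rw [(hf τ hτ).hasFDerivAt.fderiv]
  ext
  simp

/-- The n-th roots of unity form a finite, hence totally disconnected, set. -/
theorem eq_of_continuousOn_of_pow_eq_one {η : ℝ → ℂ} {s t x y : ℝ} {n : ℕ} (hn : 1 ≤ n)
    (hη : ContinuousOn η (Ioo s t)) (h : ∀ τ ∈ Ioo s t, η τ ^ n = 1) (hx : x ∈ Ioo s t)
    (hy : y ∈ Ioo s t) : η x = η y := by
  have hfin : {z : ℂ | z ^ n = 1}.Finite := by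
    refine (Polynomial.nthRootsFinset n (1 : ℂ)).finite_toSet.subset fun z hz => ?_
    rw [Finset.mem_coe, Polynomial.mem_nthRootsFinset (by omega)]
    exact hz
  have h1 : (η '' Ioo s t).Subsingleton :=
    hfin.countable.isTotallyDisconnected _ (by rintro _ ⟨τ, hτ, rfl⟩; exact h τ hτ)
      (isPreconnected_Ioo.image _ hη)
  exact h1 (mem_image_of_mem _ hx) (mem_image_of_mem _ hy)

theorem invFunOn_Icc {φ : ℝ → ℝ} {b : ℝ} (hb : 0 ≤ b) (hc : ContinuousOn φ (Icc 0 b))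
    (hm : StrictMonoOn φ (Icc 0 b)) :
    ContinuousOn (Function.invFunOn φ (Icc 0 b)) (Icc (φ 0) (φ b)) ∧
    MapsTo (Function.invFunOn φ (Icc 0 b)) (Icc (φ 0) (φ b)) (Icc 0 b) ∧
    (∀ x ∈ Icc (φ 0) (φ b), φ (Function.invFunOn φ (Icc 0 b) x) = x) ∧
    (∀ x ∈ Icc 0 b, Function.invFunOn φ (Icc 0 b) (φ x) = x) := by
  have himg : SurjOn φ (Icc 0 b) (Icc (φ 0) (φ b)) := intermediate_value_Icc hb hc
  have hmaps : MapsTo (Function.invFunOn φ (Icc 0 b)) (Icc (φ 0) (φ b)) (Icc 0 b) :=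
    himg.mapsTo_invFunOn
  have hr : ∀ x ∈ Icc (φ 0) (φ b), φ (Function.invFunOn φ (Icc 0 b) x) = x := fun x hx =>
    himg.rightInvOn_invFunOn hx
  have hl : ∀ x ∈ Icc 0 b, Function.invFunOn φ (Icc 0 b) (φ x) = x := fun x hx =>
    hm.injOn.leftInvOn_invFunOn hx
  refine ⟨?_, hmaps, hr, hl⟩
  -- The preimage of a closed set under the inverse is its image under φ, which is compact.
  rw [continuousOn_iff_isClosed]
  intro u hu
  refine ⟨φ '' (u ∩ Icc 0 b), ?_, ?_⟩
  · exact ((isCompact_Icc.inter_left hu).image_of_continuousOn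
      (hc.mono inter_subset_right)).isClosed
  · ext x
    constructor
    · rintro ⟨h1, h2⟩
      exact ⟨⟨_, ⟨h1, hmaps h2⟩, hr x h2⟩, h2⟩
    · rintro ⟨⟨z, ⟨h1, h2⟩, rfl⟩, h3⟩
      refine ⟨?_, h3⟩
      rw [mem_preimage, hl z h2]
      exact h1

/-! ### Streamlines of the model field -/

/-- Integrating y' / y gives a logarithm along the curve even if the curve winds around 0; it serves
to form the fractional power y ^ (m/N). -/
theorem exists_continuous_log {y y' : ℝ → ℂ} {s t : ℝ} (hst : s < t)
    (hne : ∀ τ ∈ Ioo s t, y τ ≠ 0) (hder : ∀ τ ∈ Ioo s t, HasDerivAt y (y' τ) τ)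
    (hc : ContinuousOn y' (Ioo s t)) :
    ∃ L : ℝ → ℂ, ∀ τ ∈ Ioo s t, HasDerivAt L (y' τ / y τ) τ ∧ Complex.exp (L τ) = y τ := by
  obtain ⟨τ₀, hτ₀⟩ := exists_between hst
  have hyc : ContinuousOn y (Ioo s t) := fun τ hτ => (hder τ hτ).continuousAt.continuousWithinAt
  set L : ℝ → ℂ := fun τ => Complex.log (y τ₀) + ∫ x in τ₀..τ, y' x / y x with hL
  have hLd : ∀ τ ∈ Ioo s t, HasDerivAt L (y' τ / y τ) τ := fun τ hτ =>
    (hasDerivAt_integral_of_continuousOn_Ioo (hc.div hyc hne) hτ₀ hτ).const_add _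
  refine ⟨L, fun τ hτ => ⟨hLd τ hτ, ?_⟩⟩
  have h1 : ∀ τ ∈ Ioo s t, HasDerivAt (fun τ => y τ * Complex.exp (-L τ)) 0 τ := by
    intro τ hτ
    refine ((hder τ hτ).mul (hLd τ hτ).fun_neg.cexp).congr_deriv ?_
    have := hne τ hτ
    field_simp
    ring
  have h2 := eq_of_hasDerivAt_zero_Ioo h1 hτ hτ₀
  have h3 : L τ₀ = Complex.log (y τ₀) := by simp [hL]
  rw [h3, Complex.exp_neg, Complex.exp_neg, Complex.exp_log (hne τ₀ hτ₀),
    mul_inv_cancel₀ (hne τ₀ hτ₀)] at h2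
  have := Complex.exp_ne_zero (L τ)
  field_simp at h2
  exact h2.symm

theorem tendsto_zero_of_pow_tendsto_zero {α : Type*} {l : Filter α} {g : α → ℝ} {n : ℕ}
    (h0 : ∀ x, 0 ≤ g x) (h : Tendsto (fun x => g x ^ n) l (𝓝 0)) (hn : 1 ≤ n) :
    Tendsto g l (𝓝 0) := by
  have hn0 : n ≠ 0 := by omega
  have h1 : Tendsto (fun x => (g x ^ n) ^ ((n : ℝ)⁻¹)) l (𝓝 ((0 : ℝ) ^ ((n : ℝ)⁻¹))) :=
    h.rpow_const (Or.inr (by positivity))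
  rw [Real.zero_rpow (by positivity)] at h1
  refine h1.congr fun x => ?_
  exact Real.pow_rpow_inv_natCast (h0 x) hn0

/-- The substitution ζ = y ^ (m/N) straightens the field: N-th powers of its velocity are positive.
The limit 0 at the start singles out the rays among all straight lines. -/
theorem model_streamline_eq_ray {N m : ℕ} {d : ℤ} (hN : 1 ≤ N) (hm : 1 ≤ m) (hd : (m : ℤ) + d = N)
    {y y' : ℝ → ℂ} {s t : ℝ} (hst : s < t) (hy0 : Tendsto y (𝓝[>] s) (𝓝 0))
    (hne : ∀ τ ∈ Ioo s t, y τ ≠ 0) (hder : ∀ τ ∈ Ioo s t, HasDerivAt y (y' τ) τ)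
    (hc : ContinuousOn y' (Ioo s t))
    (hfield : ∀ τ ∈ Ioo s t, ∃ c : ℝ, 0 < c ∧ y' τ ^ N = c * y τ ^ d) :
    ∃ ξ : ℂ, ξ ^ m = 1 ∧ ∀ τ ∈ Ioo s t, y τ = ‖y τ‖ * ξ ∧ y' τ = ‖y' τ‖ * ξ := by
  have hN0 : (N : ℂ) ≠ 0 := by exact_mod_cast (by omega : N ≠ 0)
  have hyc : ContinuousOn y (Ioo s t) := fun τ hτ => (hder τ hτ).continuousAt.continuousWithinAt
  obtain ⟨L, hL⟩ := exists_continuous_log hst hne hder hc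
  set ζ : ℝ → ℂ := fun τ => Complex.exp (m / N * L τ) with hζ
  have hζN : ∀ τ ∈ Ioo s t, ζ τ ^ N = y τ ^ m := by
    intro τ hτ
    rw [← (hL τ hτ).2, hζ, ← Complex.exp_nat_mul, ← Complex.exp_nat_mul]
    congr 1
    field_simp
  -- Up to the factor m/N this is ζ'. Its N-th power is c y ^ (d - N + m) = c, because m + d = N.
  set v : ℝ → ℂ := fun τ => y' τ / y τ * ζ τ with hv
  have hζd : ∀ τ ∈ Ioo s t, HasDerivAt ζ (m / N * v τ) τ := by
    intro τ hτ
    refine ((hL τ hτ).1.const_mul (m / N : ℂ)).cexp.congr_deriv ?_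
    simp only [hv, hζ]
    ring
  have hvN : ∀ τ ∈ Ioo s t, ∃ c : ℝ, 0 < c ∧ v τ ^ N = c := by
    intro τ hτ
    obtain ⟨c, hc0, h⟩ := hfield τ hτ
    refine ⟨c, hc0, ?_⟩
    have hyτ := hne τ hτ
    simp only [hv]
    rw [mul_pow, div_pow, hζN τ hτ, h, ← zpow_natCast (y τ) N, ← hd, zpow_add₀ hyτ, zpow_natCast]
    have h1 := zpow_ne_zero d hyτ
    have h2 := pow_ne_zero m hyτ
    field_simp
  have hvne : ∀ τ ∈ Ioo s t, v τ ≠ 0 := by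
    intro τ hτ h
    obtain ⟨c, hc0, h'⟩ := hvN τ hτ
    rw [h, zero_pow (by omega)] at h'
    exact hc0.ne (by exact_mod_cast h')
  have hζc : ContinuousOn ζ (Ioo s t) := fun τ hτ => (hζd τ hτ).continuousAt.continuousWithinAt
  have hvc : ContinuousOn v (Ioo s t) := (hc.div hyc hne).mul hζc
  have hpos_root : ∀ (n : ℕ) (z : ℂ) (c : ℝ), 0 < c → z ≠ 0 → z ^ n = c →
      (z / (‖z‖ : ℂ)) ^ n = 1 := by
    intro n z c hc0 hz h
    have h1 : ‖z‖ ^ n = c := by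
      rw [← norm_pow, h, Complex.norm_real, Real.norm_eq_abs, abs_of_pos hc0]
    rw [div_pow, h, ← Complex.ofReal_pow, h1, div_self]
    exact_mod_cast hc0.ne'
  obtain ⟨τ₀, hτ₀⟩ := exists_between hst
  have hconst : ∀ (w : ℝ → ℂ), ContinuousOn w (Ioo s t) → (∀ τ ∈ Ioo s t, w τ ≠ 0) →
      ∀ n : ℕ, 1 ≤ n → (∀ τ ∈ Ioo s t, ∃ c : ℝ, 0 < c ∧ w τ ^ n = c) →
      ∃ η : ℂ, η ^ n = 1 ∧ ∀ τ ∈ Ioo s t, w τ = ‖w τ‖ * η := by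
    intro w hwc hw0 n hn hw
    have h1 : ∀ τ ∈ Ioo s t, (w τ / (‖w τ‖ : ℂ)) ^ n = 1 := by
      intro τ hτ
      obtain ⟨c, hc0, h⟩ := hw τ hτ
      exact hpos_root n _ c hc0 (hw0 τ hτ) h
    have h2 : ContinuousOn (fun τ => w τ / (‖w τ‖ : ℂ)) (Ioo s t) :=
      hwc.div (Complex.continuous_ofReal.comp_continuousOn hwc.norm)
        (fun τ hτ => by simpa using hw0 τ hτ)
    refine ⟨_, h1 τ₀ hτ₀, fun τ hτ => ?_⟩
    rw [← eq_of_continuousOn_of_pow_eq_one hn h2 h1 hτ hτ₀]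
    have : (‖w τ‖ : ℂ) ≠ 0 := by simpa using hw0 τ hτ
    field_simp
  obtain ⟨η, hηN, hη⟩ := hconst v hvc hvne N hN hvN
  have hη0 : η ≠ 0 := by rintro rfl; rw [zero_pow (by omega)] at hηN; exact zero_ne_one hηN
  -- Divided by the constant direction η, ζ has positive real derivative and limit 0, so it is real
  -- and positive.
  have hXd : ∀ τ ∈ Ioo s t, HasDerivAt (fun τ => ζ τ / η) ((m / N * ‖v τ‖ : ℝ) : ℂ) τ := by
    intro τ hτ
    refine ((hζd τ hτ).div_const η).congr_deriv ?_
    conv_lhs => rw [hη τ hτ]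
    push_cast
    field_simp
  have hζ0 : Tendsto ζ (𝓝[>] s) (𝓝 0) := by
    rw [tendsto_zero_iff_norm_tendsto_zero]
    refine tendsto_zero_of_pow_tendsto_zero (n := N) (fun _ => norm_nonneg _) ?_ hN
    have h1 : Tendsto (fun τ => ‖y τ‖ ^ m) (𝓝[>] s) (𝓝 0) := by
      have := (hy0.norm.pow m)
      rwa [norm_zero, zero_pow (by omega)] at this
    refine h1.congr' ?_
    filter_upwards [Ioo_mem_nhdsGT hst] with τ hτ
    rw [← norm_pow, ← norm_pow, hζN τ hτ]
  have hX0 : Tendsto (fun τ => ζ τ / η) (𝓝[>] s) (𝓝 0) := by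
    simpa using hζ0.div_const η
  have him : ∀ τ ∈ Ioo s t, (ζ τ / η).im = 0 := by
    intro τ hτ
    have h1 : ∀ τ ∈ Ioo s t, HasDerivAt (fun τ => (ζ τ / η).im) 0 τ := by
      intro τ hτ
      exact (Complex.imCLM.hasFDerivAt.comp_hasDerivAt τ (hXd τ hτ)).congr_deriv (by simp)
    have h2 : Tendsto (fun τ => (ζ τ / η).im) (𝓝[>] s) (𝓝 0) := by
      have := (Complex.continuous_im.tendsto _).comp hX0
      rwa [Complex.zero_im] at this
    refine tendsto_nhds_unique (tendsto_const_nhds.congr' ?_) h2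
    filter_upwards [Ioo_mem_nhdsGT hst] with τ' hτ'
    exact eq_of_hasDerivAt_zero_Ioo h1 hτ hτ'
  have hre : ∀ τ ∈ Ioo s t, 0 < (ζ τ / η).re := by
    have h1 : ∀ τ ∈ Ioo s t, HasDerivAt (fun τ => (ζ τ / η).re) (m / N * ‖v τ‖) τ := by
      intro τ hτ
      exact (Complex.reCLM.hasFDerivAt.comp_hasDerivAt τ (hXd τ hτ)).congr_deriv (by simp)
    have h2 : StrictMonoOn (fun τ => (ζ τ / η).re) (Ioo s t) := by
      apply strictMonoOn_of_deriv_pos (convex_Ioo s t)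
        (fun τ hτ => (h1 τ hτ).continuousAt.continuousWithinAt)
      intro τ hτ
      rw [interior_Ioo] at hτ
      rw [(h1 τ hτ).deriv]
      have := norm_pos_iff.2 (hvne τ hτ)
      positivity
    have h3 : Tendsto (fun τ => (ζ τ / η).re) (𝓝[>] s) (𝓝 0) := by
      have := (Complex.continuous_re.tendsto _).comp hX0
      rwa [Complex.zero_re] at this
    intro τ hτ
    obtain ⟨τ₁, hτ₁⟩ := exists_between hτ.1
    have hτ₁' : τ₁ ∈ Ioo s t := ⟨hτ₁.1, hτ₁.2.trans hτ.2⟩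
    have h4 : 0 ≤ (ζ τ₁ / η).re := by
      refine le_of_tendsto h3 ?_
      filter_upwards [Ioo_mem_nhdsGT hτ₁.1] with τ' hτ'
      exact (h2 ⟨hτ'.1, hτ'.2.trans hτ₁'.2⟩ hτ₁' hτ'.2).le
    exact h4.trans_lt (h2 hτ₁' hτ hτ₁.2)
  have hζx : ∀ τ ∈ Ioo s t, ζ τ = ((ζ τ / η).re : ℂ) * η := by
    intro τ hτ
    have : ζ τ / η = ((ζ τ / η).re : ℂ) := Complex.ext (by simp) (by simpa using him τ hτ)
    rw [← this, div_mul_cancel₀ _ hη0]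
  obtain ⟨ξ, hξm, hξ⟩ := hconst y hyc hne m hm (by
    intro τ hτ
    refine ⟨(ζ τ / η).re ^ N, pow_pos (hre τ hτ) N, ?_⟩
    rw [← hζN τ hτ]
    nth_rewrite 1 [hζx τ hτ]
    rw [mul_pow, hηN, mul_one, Complex.ofReal_pow])
  refine ⟨ξ, hξm, fun τ hτ => ⟨hξ τ hτ, ?_⟩⟩
  -- The quotient y' / y = v / ζ is a nonnegative real since both v and ζ point along η; hence y'
  -- has the same direction ξ as y.
  have hq : y' τ / y τ = ((‖v τ‖ / (ζ τ / η).re : ℝ) : ℂ) := by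
    have h1 := hη τ hτ
    simp only [hv] at h1
    rw [hζx τ hτ] at h1
    have h2 : ((ζ τ / η).re : ℂ) ≠ 0 := by exact_mod_cast (hre τ hτ).ne'
    rw [Complex.ofReal_div, eq_div_iff h2]
    apply mul_right_cancel₀ hη0
    rw [mul_assoc, h1, ← hζx τ hτ]
  have hq0 : 0 ≤ ‖v τ‖ / (ζ τ / η).re := div_nonneg (norm_nonneg _) (hre τ hτ).le
  have hyy : y' τ = ((‖v τ‖ / (ζ τ / η).re : ℝ) : ℂ) * y τ := by
    rw [← hq, div_mul_cancel₀ _ (hne τ hτ)]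
  have hn : ‖y' τ‖ = ‖v τ‖ / (ζ τ / η).re * ‖y τ‖ := by
    rw [hyy, norm_mul, Complex.norm_real, Real.norm_eq_abs, abs_of_nonneg hq0]
  rw [hn, Complex.ofReal_mul, mul_assoc, ← hξ τ hτ]
  exact hyy

/-! ### Images of rays, parametrized by arc length -/

/-- The length of the image under `G` of the segment from `0` to `x ξ`. -/
def rayTime (G : ℂ → ℂ) (ξ : ℂ) (x : ℝ) : ℝ := ∫ t in (0 : ℝ)..x, ‖deriv G (t * ξ)‖

/-- The inverse of `rayTime` on `[0, b]`. -/
def rayParam (G : ℂ → ℂ) (ξ : ℂ) (b : ℝ) : ℝ → ℝ := Function.invFunOn (rayTime G ξ) (Icc 0 b)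

/-- The image under `G` of the segment from `0` to `b ξ`, parametrized by arc length. -/
def ray (G : ℂ → ℂ) (ξ : ℂ) (b τ : ℝ) : ℂ := G (rayParam G ξ b τ * ξ)

theorem rayTime_zero (G : ℂ → ℂ) (ξ : ℂ) : rayTime G ξ 0 = 0 := by simp [rayTime]

theorem ofReal_mul_mem_ball {ξ : ℂ} (hξ : ‖ξ‖ = 1) {x ρ : ℝ} (hx : x ∈ Ioo (-ρ) ρ) :
    (x * ξ : ℂ) ∈ Metric.ball (0 : ℂ) ρ := by
  rw [mem_ball_zero_iff, norm_mul, hξ, mul_one, Complex.norm_real, Real.norm_eq_abs]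
  exact abs_lt.2 hx

namespace IsNaturalChart

variable {N m : ℕ} {d : ℤ} {u : ℂ → ℂ} {a ξ : ℂ} {ρ b : ℝ} {G V : ℂ → ℂ}

theorem hasDerivAt (h : IsNaturalChart N d u a ρ G V) {y : ℂ} (hy : y ∈ Metric.ball (0 : ℂ) ρ) :
    HasDerivAt G (deriv G y) y :=
  (h.differentiableOn.differentiableAt (Metric.isOpen_ball.mem_nhds hy)).hasDerivAt

theorem continuousOn_deriv (h : IsNaturalChart N d u a ρ G V) :
    ContinuousOn (deriv G) (Metric.ball 0 ρ) :=
  (h.differentiableOn.deriv Metric.isOpen_ball).continuousOn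

theorem injOn (h : IsNaturalChart N d u a ρ G V) : InjOn G (Metric.ball 0 ρ) := by
  intro y hy z hz hyz
  rw [← h.left_inv y hy, hyz, h.left_inv z hz]

theorem hasDerivAt_rayTime (h : IsNaturalChart N d u a ρ G V) (hξ : ‖ξ‖ = 1) {x : ℝ}
    (hx : x ∈ Ioo (-ρ) ρ) : HasDerivAt (rayTime G ξ) ‖deriv G (x * ξ)‖ x := by
  have h0 : (0 : ℝ) ∈ Ioo (-ρ) ρ := ⟨neg_lt_zero.2 h.pos, h.pos⟩
  refine hasDerivAt_integral_of_continuousOn_Ioo (f := fun t : ℝ => ‖deriv G (t * ξ)‖) ?_ h0 hx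
  exact (h.continuousOn_deriv.comp (by fun_prop)
    (fun t ht => ofReal_mul_mem_ball hξ ht)).norm

theorem strictMonoOn_rayTime (h : IsNaturalChart N d u a ρ G V) (hξ : ‖ξ‖ = 1) :
    StrictMonoOn (rayTime G ξ) (Ioo (-ρ) ρ) := by
  apply strictMonoOn_of_deriv_pos (convex_Ioo _ _)
    (fun x hx => (h.hasDerivAt_rayTime hξ hx).continuousAt.continuousWithinAt)
  intro x hx
  rw [interior_Ioo] at hx
  rw [(h.hasDerivAt_rayTime hξ hx).deriv]
  exact norm_pos_iff.2 (h.deriv_ne_zero _ (ofReal_mul_mem_ball hξ hx))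

theorem Icc_subset (h : IsNaturalChart N d u a ρ G V) (hb : b < ρ) :
    Icc 0 b ⊆ Ioo (-ρ) ρ := fun _ hx => ⟨by linarith [h.pos, hx.1], hx.2.trans_lt hb⟩

theorem rayTime_pos (h : IsNaturalChart N d u a ρ G V) (hξ : ‖ξ‖ = 1) (hb : b ∈ Ioo 0 ρ) :
    0 < rayTime G ξ b := by
  rw [← rayTime_zero G ξ]
  exact h.strictMonoOn_rayTime hξ (h.Icc_subset hb.2 (left_mem_Icc.2 hb.1.le))
    (h.Icc_subset hb.2 (right_mem_Icc.2 hb.1.le)) hb.1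

theorem rayParam_spec (h : IsNaturalChart N d u a ρ G V) (hξ : ‖ξ‖ = 1) (hb : b ∈ Ioo 0 ρ) :
    ContinuousOn (rayParam G ξ b) (Icc 0 (rayTime G ξ b)) ∧
    MapsTo (rayParam G ξ b) (Icc 0 (rayTime G ξ b)) (Icc 0 b) ∧
    (∀ x ∈ Icc 0 (rayTime G ξ b), rayTime G ξ (rayParam G ξ b x) = x) ∧
    (∀ x ∈ Icc 0 b, rayParam G ξ b (rayTime G ξ x) = x) := by
  have := invFunOn_Icc (φ := rayTime G ξ) hb.1.le
    (fun x hx => (h.hasDerivAt_rayTime hξ (h.Icc_subset hb.2 hx)).continuousAt.continuousWithinAt)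
    ((h.strictMonoOn_rayTime hξ).mono (h.Icc_subset hb.2))
  rwa [rayTime_zero] at this

theorem rayParam_zero (h : IsNaturalChart N d u a ρ G V) (hξ : ‖ξ‖ = 1) (hb : b ∈ Ioo 0 ρ) :
    rayParam G ξ b 0 = 0 := by
  have := (h.rayParam_spec hξ hb).2.2.2 0 (left_mem_Icc.2 hb.1.le)
  rwa [rayTime_zero] at this

theorem ray_zero (h : IsNaturalChart N d u a ρ G V) (hξ : ‖ξ‖ = 1) (hb : b ∈ Ioo 0 ρ) :
    ray G ξ b 0 = a := by
  rw [ray, h.rayParam_zero hξ hb, Complex.ofReal_zero, zero_mul, h.map_zero]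

theorem rayParam_mem_Ioo (h : IsNaturalChart N d u a ρ G V) (hξ : ‖ξ‖ = 1) (hb : b ∈ Ioo 0 ρ)
    {τ : ℝ} (hτ : τ ∈ Ioo 0 (rayTime G ξ b)) : rayParam G ξ b τ ∈ Ioo 0 b := by
  obtain ⟨-, hm, hr, -⟩ := h.rayParam_spec hξ hb
  have h1 := hm (Ioo_subset_Icc_self hτ)
  have h2 := hr τ (Ioo_subset_Icc_self hτ)
  refine ⟨lt_of_le_of_ne h1.1 ?_, lt_of_le_of_ne h1.2 ?_⟩
  · intro h3
    rw [← h3, rayTime_zero] at h2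
    exact hτ.1.ne h2
  · intro h3
    rw [h3] at h2
    exact hτ.2.ne' h2

theorem hasDerivAt_rayParam (h : IsNaturalChart N d u a ρ G V) (hξ : ‖ξ‖ = 1) (hb : b ∈ Ioo 0 ρ)
    {τ : ℝ} (hτ : τ ∈ Ioo 0 (rayTime G ξ b)) :
    HasDerivAt (rayParam G ξ b) ‖deriv G (rayParam G ξ b τ * ξ)‖⁻¹ τ := by
  obtain ⟨hc, hm, hr, -⟩ := h.rayParam_spec hξ hb
  have h1 := h.Icc_subset hb.2 (hm (Ioo_subset_Icc_self hτ))
  refine (h.hasDerivAt_rayTime hξ h1).of_local_left_inverse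
    (hc.continuousAt (Icc_mem_nhds hτ.1 hτ.2)) ?_ ?_
  · exact norm_ne_zero_iff.2 (h.deriv_ne_zero _ (ofReal_mul_mem_ball hξ h1))
  · filter_upwards [Icc_mem_nhds hτ.1 hτ.2] with x hx using hr x hx

theorem hasDerivAt_ray (h : IsNaturalChart N d u a ρ G V) (hξ : ‖ξ‖ = 1) (hb : b ∈ Ioo 0 ρ)
    {τ : ℝ} (hτ : τ ∈ Ioo 0 (rayTime G ξ b)) :
    HasDerivAt (ray G ξ b) (deriv G (rayParam G ξ b τ * ξ) * ξ /
      (‖deriv G (rayParam G ξ b τ * ξ) * ξ‖ : ℂ)) τ := by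
  have h1 : (rayParam G ξ b τ * ξ : ℂ) ∈ Metric.ball (0 : ℂ) ρ :=
    ofReal_mul_mem_ball hξ (h.Icc_subset hb.2 (Ioo_subset_Icc_self (h.rayParam_mem_Ioo hξ hb hτ)))
  have h2 := ((h.hasDerivAt_rayParam hξ hb hτ).ofReal_comp).mul_const ξ
  refine ((h.hasDerivAt h1).comp τ h2).congr_deriv ?_
  rw [norm_mul, hξ, mul_one]
  push_cast
  ring

theorem ray_image (h : IsNaturalChart N d u a ρ G V) (hξ : ‖ξ‖ = 1) (hb : b ∈ Ioo 0 ρ) :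
    ray G ξ b '' Ico 0 (rayTime G ξ b) = (fun x : ℝ => G (x * ξ)) '' Ico 0 b := by
  obtain ⟨hc, hm, hr, hl⟩ := h.rayParam_spec hξ hb
  ext z
  constructor
  · rintro ⟨τ, hτ, rfl⟩
    refine ⟨rayParam G ξ b τ, ?_, rfl⟩
    rcases eq_or_lt_of_le hτ.1 with h0 | h0
    · rw [← h0, h.rayParam_zero hξ hb]; exact left_mem_Ico.2 hb.1
    · exact Ioo_subset_Ico_self (h.rayParam_mem_Ioo hξ hb ⟨h0, hτ.2⟩)
  · rintro ⟨x, hx, rfl⟩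
    have hmono := h.strictMonoOn_rayTime hξ
    refine ⟨rayTime G ξ x, ⟨?_, ?_⟩, ?_⟩
    · rw [← rayTime_zero G ξ]
      exact hmono.monotoneOn (h.Icc_subset hb.2 (left_mem_Icc.2 hb.1.le))
        (h.Icc_subset hb.2 (Ico_subset_Icc_self hx)) hx.1
    · exact hmono (h.Icc_subset hb.2 (Ico_subset_Icc_self hx))
        (h.Icc_subset hb.2 (right_mem_Icc.2 hb.1.le)) hx.2
    · rw [ray, hl x (Ico_subset_Icc_self hx)]

/-- One common point at a positive time suffices: G is injective, so x₁ ξ₁ = x₂ ξ₂ with positive x₁,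
x₂, and taking norms gives x₁ = x₂. -/
theorem eq_of_ray_eventuallyEq (h : IsNaturalChart N d u a ρ G V) {ξ₁ ξ₂ : ℂ} {b₁ b₂ : ℝ}
    (hξ₁ : ‖ξ₁‖ = 1) (hξ₂ : ‖ξ₂‖ = 1) (hb₁ : b₁ ∈ Ioo 0 ρ) (hb₂ : b₂ ∈ Ioo 0 ρ)
    (he : ray G ξ₁ b₁ =ᶠ[𝓝[≥] 0] ray G ξ₂ b₂) : ξ₁ = ξ₂ := by
  have he' : ray G ξ₁ b₁ =ᶠ[𝓝[>] 0] ray G ξ₂ b₂ :=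
    he.filter_mono (nhdsWithin_mono _ Ioi_subset_Ici_self)
  obtain ⟨τ, ⟨hτ, hτ₁⟩, hτ₂⟩ := ((he'.and (Ioo_mem_nhdsGT (h.rayTime_pos hξ₁ hb₁))).and
    (Ioo_mem_nhdsGT (h.rayTime_pos hξ₂ hb₂))).exists
  have h1 := h.rayParam_mem_Ioo hξ₁ hb₁ hτ₁
  have h2 := h.rayParam_mem_Ioo hξ₂ hb₂ hτ₂
  have h3 := h.injOn (ofReal_mul_mem_ball hξ₁ (h.Icc_subset hb₁.2 (Ioo_subset_Icc_self h1)))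
    (ofReal_mul_mem_ball hξ₂ (h.Icc_subset hb₂.2 (Ioo_subset_Icc_self h2))) hτ
  have h4 : rayParam G ξ₁ b₁ τ = rayParam G ξ₂ b₂ τ := by
    have := congrArg norm h3
    simpa [hξ₁, hξ₂, abs_of_pos h1.1, abs_of_pos h2.1] using this
  rw [h4] at h3
  exact mul_left_cancel₀ (by exact_mod_cast h2.1.ne') h3

end IsNaturalChart

/-! ### Streamlines from the singularity -/

/-- A complex number of norm one, as an element of the circle. -/
def circleMk (z : ℂ) (hz : ‖z‖ = 1) : Circle where
  val := z
  property := mem_sphere_zero_iff_norm.2 hz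

/-- The direction of a nonzero complex number, as an element of the circle. -/
def circleDir (z : ℂ) : Circle :=
  if h : z = 0 then 1 else circleMk (z / (‖z‖ : ℂ)) (by
    rw [norm_div, Complex.norm_real, norm_norm, div_self (norm_ne_zero_iff.2 h)])

theorem coe_circleDir {z : ℂ} (hz : z ≠ 0) : (circleDir z : ℂ) = z / (‖z‖ : ℂ) := by
  rw [circleDir, dif_neg hz]
  rfl

theorem isInducing_circle_coe : Topology.IsInducing (fun w : Circle => (w : ℂ)) := ⟨rfl⟩

theorem norm_reprField {N : ℕ} (f : ℂ → WithZero (NDirection N)) {z : ℂ}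
    (h : reprField f z ≠ 0) : ‖reprField f z‖ = 1 := by
  unfold reprField at h ⊢
  split at h
  · exact absurd rfl h
  · exact Circle.norm_coe _

theorem eq_of_eq_pos_mul {z w : ℂ} {c : ℝ} (hc : 0 < c) (h : z = c * w) (hz : ‖z‖ = 1)
    (hw : ‖w‖ = 1) : z = w := by
  have := congrArg norm h
  rw [norm_mul, Complex.norm_real, Real.norm_eq_abs, abs_of_pos hc, hz, hw, mul_one] at this
  rw [h, ← this, Complex.ofReal_one, one_mul]

namespace IsNaturalChart

variable {N m : ℕ} {d : ℤ} {a ξ : ℂ} {ρ b : ℝ} {G V : ℂ → ℂ} {D : Set ℂ}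
  {f : ℂ → WithZero (NDirection N)}

/-- For ξ ^ m = 1 one has ξ ^ N = ξ ^ d, so at y = xξ the field c G' ^ N y ^ d is a positive
multiple of (G' ξ) ^ N, the N-th power of the velocity direction; two unit numbers with positive
ratio agree. -/
theorem ray_isStreamline (h : IsNaturalChart N d (reprField f) a ρ G V) (hm : 1 ≤ m)
    (hd : (m : ℤ) + d = N) (hGD : ∀ y ∈ Metric.ball (0 : ℂ) ρ, G y ∈ D) (hξm : ξ ^ m = 1)
    (hb : b ∈ Ioo 0 ρ) : IsStreamline D f (ray G ξ b) 0 (rayTime G ξ b) := by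
  have hξ : ‖ξ‖ = 1 := Complex.norm_eq_one_of_pow_eq_one hξm (by omega)
  have hξ0 : ξ ≠ 0 := by rintro rfl; simp at hξ
  have hξN : ξ ^ N = ξ ^ d := by
    rw [← zpow_natCast, ← hd, zpow_add₀ hξ0, zpow_natCast, hξm, one_mul]
  obtain ⟨hc, hmaps, -, -⟩ := h.rayParam_spec hξ hb
  have hball : ∀ τ ∈ Icc 0 (rayTime G ξ b),
      (rayParam G ξ b τ * ξ : ℂ) ∈ Metric.ball (0 : ℂ) ρ := fun τ hτ =>
    ofReal_mul_mem_ball hξ (h.Icc_subset hb.2 (hmaps hτ))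
  have hcξ : ContinuousOn (fun τ => (rayParam G ξ b τ * ξ : ℂ)) (Icc 0 (rayTime G ξ b)) :=
    (Complex.continuous_ofReal.comp_continuousOn hc).mul continuousOn_const
  set v : ℝ → ℂ := fun τ => deriv G (rayParam G ξ b τ * ξ) * ξ with hv
  have hv0 : ∀ τ ∈ Ioo 0 (rayTime G ξ b), v τ ≠ 0 := fun τ hτ =>
    mul_ne_zero (h.deriv_ne_zero _ (hball τ (Ioo_subset_Icc_self hτ))) hξ0
  have hvc : ContinuousOn v (Ioo 0 (rayTime G ξ b)) :=
    ((h.continuousOn_deriv.comp hcξ hball).mono Ioo_subset_Icc_self).mul continuousOn_const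
  refine ⟨h.rayTime_pos hξ hb, h.differentiableOn.continuousOn.comp hcξ hball,
    fun τ => circleDir (v τ), ?_, fun τ hτ => ⟨⟨hGD _ (hball τ (Ioo_subset_Icc_self hτ)), ?_⟩, ?_⟩⟩
  · rw [isInducing_circle_coe.continuousOn_iff]
    refine (hvc.div (Complex.continuous_ofReal.comp_continuousOn hvc.norm)
      (fun τ hτ => by simpa using hv0 τ hτ)).congr fun τ hτ => ?_
    exact coe_circleDir (hv0 τ hτ)
  · rw [eq_mk_iff]
    have hx := (h.rayParam_mem_Ioo hξ hb hτ).1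
    set x := rayParam G ξ b τ with hxdef
    obtain ⟨c, hc0, hu⟩ := h.field (x * ξ) (hball τ (Ioo_subset_Icc_self hτ))
      (mul_ne_zero (by exact_mod_cast hx.ne') hξ0)
    have hn : 0 < ‖v τ‖ := norm_pos_iff.2 (hv0 τ hτ)
    have hx0 : (x : ℂ) ≠ 0 := by exact_mod_cast hx.ne'
    have hu' : reprField f (ray G ξ b τ) =
        ((c * x ^ d * ‖v τ‖ ^ N : ℝ) : ℂ) * (circleDir (v τ) : ℂ) ^ N := by
      rw [coe_circleDir (hv0 τ hτ), ray, ← hxdef, hu, mul_zpow, ← hξN]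
      have h1 : (‖v τ‖ : ℂ) ≠ 0 := by exact_mod_cast hn.ne'
      push_cast
      rw [div_pow, mul_assoc _ _ (v τ ^ N / _), mul_div_cancel₀ _ (pow_ne_zero N h1)]
      simp only [hv]
      rw [← hxdef, mul_pow]
      ring
    have hpos : 0 < c * x ^ d * ‖v τ‖ ^ N := by positivity
    have hne : reprField f (ray G ξ b τ) ≠ 0 := by
      rw [hu']
      exact mul_ne_zero (by exact_mod_cast hpos.ne') (pow_ne_zero _ (Circle.coe_ne_zero _))
    exact (eq_of_eq_pos_mul hpos hu' (norm_reprField f hne)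
      (by rw [norm_pow, Circle.norm_coe, one_pow])).symm
  · simp only
    rw [coe_circleDir (hv0 τ hτ)]
    exact h.hasDerivAt_ray hξ hb hτ

/-- In the chart a separatrix solves the model equation and follows a ray; unit speed makes its
parameter the arc length. The root ξ does not depend on b, so each ray may later be cut off at its
own length. -/
theorem streamline_eventuallyEq_ray (h : IsNaturalChart N d (reprField f) a ρ G V) (hN : 1 ≤ N)
    (hm : 1 ≤ m) (hd : (m : ℤ) + d = N) (hfa : f a = 0) {σ : ℝ → ℂ} {s t : ℝ}
    (hσ : IsStreamline D f σ s t) (hσs : σ s = a) :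
    ∃ ξ : ℂ, ξ ^ m = 1 ∧ ∀ b ∈ Ioo 0 ρ, ∀ᶠ τ in 𝓝[≥] 0, σ (s + τ) = ray G ξ b τ := by
  obtain ⟨hst, hσc, w, hwc, hw⟩ := hσ
  have hσa : Tendsto σ (𝓝[>] s) (𝓝 a) := by
    have := (hσc s (left_mem_Icc.2 hst.le)).mono_of_mem_nhdsWithin (Icc_mem_nhdsGT hst)
    rwa [ContinuousWithinAt, hσs] at this
  obtain ⟨t', ht', hsub⟩ := (mem_nhdsGT_iff_exists_Ioo_subset' hst).1
    (inter_mem (hσa.eventually h.right_inv) (Ioo_mem_nhdsGT hst))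
  rw [mem_Ioi] at ht'
  have hV0 : V a = 0 := by
    rw [← h.map_zero]; exact h.left_inv 0 (Metric.mem_ball_self h.pos)
  have hright : ∀ τ ∈ Ioo s t', V (σ τ) ∈ Metric.ball (0 : ℂ) ρ ∧ G (V (σ τ)) = σ τ ∧
      HasDerivAt V (deriv G (V (σ τ)))⁻¹ (σ τ) := fun τ hτ => (hsub hτ).1
  set y : ℝ → ℂ := fun τ => V (σ τ) with hy
  set y' : ℝ → ℂ := fun τ => (deriv G (V (σ τ)))⁻¹ * w τ with hy'
  have hyd : ∀ τ ∈ Ioo s t', HasDerivAt y (y' τ) τ := fun τ hτ =>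
    (hright τ hτ).2.2.comp τ (hw τ (hsub hτ).2).2
  have hy0 : Tendsto y (𝓝[>] s) (𝓝 0) := by
    have h1 : Tendsto V (𝓝 a) (𝓝 0) := by
      have := h.right_inv.self_of_nhds.2.2.continuousAt
      rwa [ContinuousAt, hV0] at this
    exact h1.comp hσa
  have hyc : ContinuousOn y (Ioo s t') := fun τ hτ => (hyd τ hτ).continuousAt.continuousWithinAt
  have hyball : ∀ τ ∈ Ioo s t', y τ ∈ Metric.ball (0 : ℂ) ρ := fun τ hτ => (hright τ hτ).1
  -- A return to 0 would mean σ τ = a, where f vanishes and no unit vector represents it.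
  have hyne : ∀ τ ∈ Ioo s t', y τ ≠ 0 := by
    intro τ hτ h0
    have h1 := (hright τ hτ).2.1
    have h2 : V (σ τ) = 0 := h0
    rw [h2, h.map_zero] at h1
    have h3 := (hw τ (hsub hτ).2).1.2
    simp only at h3
    rw [← h1, hfa] at h3
    exact WithZero.coe_ne_zero h3.symm
  obtain ⟨ξ, hξm, hξ⟩ := model_streamline_eq_ray hN hm hd (y := y) (y' := y') ht' hy0 hyne hyd
    (((h.continuousOn_deriv.comp hyc hyball).inv₀ fun τ hτ => h.deriv_ne_zero _ (hyball τ hτ)).mul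
      (continuous_subtype_val.comp_continuousOn (hwc.mono fun τ hτ => (hsub hτ).2))) (by
      intro τ hτ
      obtain ⟨c, hc, hu⟩ := h.field _ (hyball τ hτ) (hyne τ hτ)
      refine ⟨c, hc, ?_⟩
      have h1 := (eq_mk_iff f _ _).1 (hw τ (hsub hτ).2).1.2
      simp only at h1
      have h2 : G (y τ) = σ τ := (hright τ hτ).2.1
      rw [h2] at hu
      simp only [hy']
      rw [mul_pow, h1, hu, inv_pow]
      have h3 := pow_ne_zero N (h.deriv_ne_zero _ (hyball τ hτ))
      have h4 : deriv G (V (σ τ)) = deriv G (y τ) := rfl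
      rw [h4]
      field_simp)
  have hξ1 : ‖ξ‖ = 1 := Complex.norm_eq_one_of_pow_eq_one hξm (by omega)
  have hξ0 : ξ ≠ 0 := by rintro rfl; simp at hξ1
  have hnd : ∀ τ ∈ Ioo s t', HasDerivAt (fun τ => ‖y τ‖) ‖y' τ‖ τ := by
    intro τ hτ
    have h1 := Complex.reCLM.hasFDerivAt.comp_hasDerivAt τ ((hyd τ hτ).div_const ξ)
    have h2 : HasDerivAt (fun τ => (y τ / ξ).re) ‖y' τ‖ τ := by
      refine h1.congr_deriv ?_
      conv_lhs => rw [(hξ τ hτ).2, mul_div_cancel_right₀ _ hξ0]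
      simp
    refine h2.congr_of_eventuallyEq ?_
    filter_upwards [isOpen_Ioo.mem_nhds hτ] with x hx
    conv_rhs => rw [(hξ x hx).1, mul_div_cancel_right₀ _ hξ0]
    simp
  have hnmem : ∀ τ ∈ Ioo s t', ‖y τ‖ ∈ Ioo (-ρ) ρ := fun τ hτ =>
    ⟨by linarith [h.pos, norm_nonneg (y τ)], mem_ball_zero_iff.1 (hyball τ hτ)⟩
  -- The derivative of the left side is |G'| |y'| = |w| = 1, and it tends to 0 at s.
  have htime : ∀ τ ∈ Ioo s t', rayTime G ξ ‖y τ‖ = τ - s := by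
    have hd1 : ∀ τ ∈ Ioo s t', HasDerivAt (fun τ => rayTime G ξ ‖y τ‖ - τ) 0 τ := by
      intro τ hτ
      have h1 := (h.hasDerivAt_rayTime hξ1 (hnmem τ hτ)).comp τ (hnd τ hτ)
      refine (h1.sub (hasDerivAt_id' τ)).congr_deriv ?_
      rw [← (hξ τ hτ).1]
      simp only [hy']
      rw [norm_mul, norm_inv, Circle.norm_coe, mul_one]
      have := norm_ne_zero_iff.2 (h.deriv_ne_zero _ (hyball τ hτ))
      rw [mul_inv_cancel₀ this, sub_self]
    have hlim : Tendsto (fun τ => rayTime G ξ ‖y τ‖ - τ) (𝓝[>] s) (𝓝 (0 - s)) := by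
      refine Tendsto.sub ?_ (tendsto_id.mono_left nhdsWithin_le_nhds)
      have h1 := (h.hasDerivAt_rayTime hξ1 (x := 0) ⟨neg_lt_zero.2 h.pos, h.pos⟩).continuousAt
      rw [ContinuousAt, rayTime_zero] at h1
      refine h1.comp ?_
      simpa using hy0.norm
    intro τ hτ
    have h2 : rayTime G ξ ‖y τ‖ - τ = 0 - s := by
      refine tendsto_nhds_unique (tendsto_const_nhds.congr' ?_) hlim
      filter_upwards [Ioo_mem_nhdsGT ht'] with x hx
      exact eq_of_hasDerivAt_zero_Ioo hd1 hτ hx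
    linarith
  refine ⟨ξ, hξm, fun b hb => ?_⟩
  have hsmall : ∀ᶠ τ in 𝓝[>] s, ‖y τ‖ < b ∧ τ ∈ Ioo s t' := by
    have h1 : Tendsto (fun τ => ‖y τ‖) (𝓝[>] s) (𝓝 0) := by simpa using hy0.norm
    exact (h1.eventually (gt_mem_nhds hb.1)).and (Ioo_mem_nhdsGT ht')
  have hshift : ∀ᶠ τ in 𝓝[>] (0 : ℝ), ‖y (s + τ)‖ < b ∧ s + τ ∈ Ioo s t' := by
    have h1 : Tendsto (fun τ => s + τ) (𝓝[>] 0) (𝓝[>] s) := by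
      refine tendsto_nhdsWithin_of_tendsto_nhds_of_eventually_within _ ?_ ?_
      · have : Continuous fun τ => s + τ := by fun_prop
        exact (by simpa using this.tendsto 0 : Tendsto (fun τ => s + τ) (𝓝 0) (𝓝 s)).mono_left
          nhdsWithin_le_nhds
      · filter_upwards [self_mem_nhdsWithin] with τ hτ
        exact lt_add_of_pos_right s hτ
    exact h1.eventually hsmall
  have hIci : (𝓝[≥] (0 : ℝ)) = pure 0 ⊔ 𝓝[>] 0 := by
    rw [← Ioi_insert, nhdsWithin_insert]
  rw [hIci, eventually_sup]
  refine ⟨?_, ?_⟩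
  · rw [eventually_pure, add_zero, hσs, h.ray_zero hξ1 hb]
  · filter_upwards [hshift] with τ hτ
    have h1 := htime _ hτ.2
    rw [add_sub_cancel_left] at h1
    have h2 := (h.rayParam_spec hξ1 hb).2.2.2 _ ⟨norm_nonneg _, hτ.1.le⟩
    rw [h1] at h2
    rw [ray, h2, ← (hξ _ hτ.2).1]
    exact (hright _ hτ.2).2.1.symm

end IsNaturalChart

/-! ### Reversal of streamlines -/

/-- The reversed velocity -w represents the same direction because (-1) ^ N = 1. -/
theorem IsStreamline.reverse {N : ℕ} (hN : Even N) {D : Set ℂ} {f : ℂ → WithZero (NDirection N)}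
    {σ : ℝ → ℂ} {s t : ℝ} (h : IsStreamline D f σ s t) :
    IsStreamline D f (fun τ => σ (-τ)) (-t) (-s) := by
  obtain ⟨hst, hc, w, hwc, hw⟩ := h
  have hmem : ∀ τ ∈ Ioo (-t) (-s), -τ ∈ Ioo s t := fun τ hτ =>
    ⟨by linarith [hτ.2], by linarith [hτ.1]⟩
  refine ⟨by linarith, hc.comp continuousOn_neg
    (fun τ hτ => ⟨by linarith [hτ.2], by linarith [hτ.1]⟩), fun τ => -w (-τ), ?_, fun τ hτ => ?_⟩
  · exact (hwc.comp continuousOn_neg hmem).neg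
  · obtain ⟨⟨h1, h2⟩, h3⟩ := hw (-τ) (hmem τ hτ)
    refine ⟨⟨h1, ?_⟩, ?_⟩
    · rw [eq_mk_iff] at h2 ⊢
      simp only at h2 ⊢
      rw [← h2, Circle.coe_neg, hN.neg_pow]
    · have := h3.scomp τ (hasDerivAt_neg τ)
      exact this.congr_deriv (by simp)

theorem incomingSeparatrices_eq_outgoingSeparatrices {N : ℕ} (hN : Even N) (D : Set ℂ)
    (f : ℂ → WithZero (NDirection N)) (a : ℂ) :
    incomingSeparatrices D f a = outgoingSeparatrices D f a := by
  ext g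
  constructor
  · rintro ⟨σ, s, t, h, ha, rfl⟩
    refine ⟨_, _, _, h.reverse hN, by simpa using ha, ?_⟩
    congr 1
    ext τ
    congr 1
    ring
  · rintro ⟨σ, s, t, h, ha, rfl⟩
    refine ⟨_, _, _, h.reverse hN, by simpa using ha, ?_⟩
    congr 1
    ext τ
    congr 1
    ring

/-! ### Images of rays in polar coordinates -/

theorem ofReal_mul_mem_closedBall {ξ : ℂ} (hξ : ‖ξ‖ = 1) {x b : ℝ} (hx : x ∈ Icc 0 b) :
    (x * ξ : ℂ) ∈ Metric.closedBall (0 : ℂ) b := by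
  rw [mem_closedBall_zero_iff, norm_mul, hξ, mul_one, Complex.norm_real, Real.norm_eq_abs,
    abs_of_nonneg hx.1]
  exact hx.2

namespace IsNaturalChart

variable {N : ℕ} {d : ℤ} {u : ℂ → ℂ} {a : ℂ} {ρ : ℝ} {G V : ℂ → ℂ}

/-- Write G y - a = y q(y) with q(0) = G'(0) ≠ 0. Then A is a continuous argument of q, by which G
turns each ray. All smallness conditions hold on one closed ball, hence uniformly in ξ. -/
theorem exists_polar_angle (h : IsNaturalChart N d u a ρ G V) {ε : ℝ} (hε : 0 < ε) :
    ∃ b ∈ Ioo 0 ρ, ∃ R > 0, ∃ A : ℂ → ℝ, ContinuousOn A (Metric.closedBall 0 b) ∧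
      (∀ y ∈ Metric.closedBall (0 : ℂ) b, |A y - A 0| < ε) ∧
      ∀ ξ : ℂ, ‖ξ‖ = 1 → StrictMonoOn (fun x : ℝ => ‖G (x * ξ) - a‖) (Icc 0 b) ∧
        R ≤ ‖G (b * ξ) - a‖ ∧ ∀ x ∈ Icc 0 b,
          G (x * ξ) = a + ‖G (x * ξ) - a‖ * (ξ * Complex.exp (A (x * ξ) * Complex.I)) := by
  set q : ℂ → ℂ := dslope G 0 with hq
  have hball : Metric.ball (0 : ℂ) ρ ∈ 𝓝 0 := Metric.ball_mem_nhds 0 h.pos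
  have hqd : DifferentiableOn ℂ q (Metric.ball 0 ρ) :=
    (Complex.differentiableOn_dslope hball).2 h.differentiableOn
  have hqc : ContinuousAt q 0 := (hqd.differentiableAt hball).continuousAt
  have hq0 : q 0 = deriv G 0 := dslope_same _ _
  have hq00 : q 0 ≠ 0 := by rw [hq0]; exact h.deriv_ne_zero 0 (Metric.mem_ball_self h.pos)
  have hGq : ∀ y, G y - a = y * q y := by
    intro y
    have := sub_smul_dslope G 0 y
    rw [sub_zero, smul_eq_mul, h.map_zero] at this
    exact this.symm
  set A : ℂ → ℝ := fun y => (Complex.log (q y / q 0)).im + Complex.arg (q 0) with hA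
  have hquot : ContinuousAt (fun y => q y / q 0) 0 := hqc.div_const _
  have hAc : ContinuousAt A 0 := by
    refine (Complex.continuous_im.continuousAt.comp (hquot.clog ?_)).add continuousAt_const
    simp [hq00]
  have hslit : ∀ᶠ y in 𝓝 (0 : ℂ), q y / q 0 ∈ Complex.slitPlane :=
    hquot.eventually (Complex.isOpen_slitPlane.mem_nhds (by simp [hq00]))
  have hangle : ∀ᶠ y in 𝓝 (0 : ℂ), |A y - A 0| < ε :=
    (Metric.continuousAt_iff'.1 hAc) ε hε
  have hnorm : ∀ᶠ y in 𝓝 (0 : ℂ), ‖q 0‖ / 2 < ‖q y‖ :=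
    hqc.norm.eventually (lt_mem_nhds (half_lt_self (norm_pos_iff.2 hq00)))
  -- Along a ray the x-derivative of |G(xξ) - a| ^ 2 is 2x⟨q, G'⟩, so this positivity makes the
  -- distance to a strictly increasing.
  have hinner : ∀ᶠ y in 𝓝 (0 : ℂ), 0 < inner ℝ (q y) (deriv G y) := by
    have hc : ContinuousAt (fun y => inner ℝ (q y) (deriv G y)) 0 :=
      hqc.inner (h.continuousOn_deriv.continuousAt hball)
    refine hc.eventually (lt_mem_nhds ?_)
    change 0 < inner ℝ (q 0) (deriv G 0)
    rw [← hq0, real_inner_self_eq_norm_sq]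
    have := norm_pos_iff.2 hq00
    positivity
  obtain ⟨b, hb, hbs⟩ := Metric.nhds_basis_closedBall.eventually_iff.1
    (Filter.Eventually.and (p := fun y => y ∈ Metric.ball (0 : ℂ) ρ) hball (hslit.and (hangle.and (hnorm.and hinner))))
  have hbρ : b < ρ := by
    have h1 := (hbs (ofReal_mul_mem_closedBall (ξ := 1) norm_one (right_mem_Icc.2 hb.le))).1
    rw [mem_ball_zero_iff, mul_one, Complex.norm_real, Real.norm_eq_abs, abs_of_pos hb] at h1
    exact h1
  have hq0n := norm_pos_iff.2 hq00
  refine ⟨b, ⟨hb, hbρ⟩, b * (‖q 0‖ / 2), by positivity, A, ?_, fun y hy => (hbs hy).2.2.1,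
    fun ξ hξ => ⟨?_, ?_, fun x hx => ?_⟩⟩
  · refine ContinuousOn.add ?_ continuousOn_const
    refine Complex.continuous_im.comp_continuousOn (ContinuousOn.clog ?_ fun y hy => (hbs hy).2.1)
    exact (hqd.continuousOn.mono fun y hy => (hbs hy).1).div_const _
  · have hd : ∀ x ∈ Icc 0 b, HasDerivAt (fun x : ℝ => ‖G (x * ξ) - a‖ ^ 2)
        (2 * (x * inner ℝ (q (x * ξ)) (deriv G (x * ξ)))) x := by
      intro x hx
      have h1 := hbs (ofReal_mul_mem_closedBall hξ hx)
      have h2 : HasDerivAt (fun x : ℝ => (x * ξ : ℂ)) ξ x := by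
        simpa using (Complex.ofRealCLM.hasDerivAt (x := x)).mul_const ξ
      have h3 := (((h.hasDerivAt h1.1).comp x h2).sub_const a).norm_sq
      refine h3.congr_deriv ?_
      simp only [Function.comp]
      rw [hGq, Complex.inner, Complex.inner]
      have h4 : (starRingEnd ℂ) ξ * ξ = 1 := by
        rw [mul_comm, Complex.mul_conj, Complex.normSq_eq_norm_sq, hξ]; simp
      have h5 : (starRingEnd ℂ) (x * ξ * q (x * ξ)) * (deriv G (x * ξ) * ξ) =
          x * ((starRingEnd ℂ) (q (x * ξ)) * deriv G (x * ξ)) := by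
        simp only [map_mul, Complex.conj_ofReal]
        linear_combination (x * (starRingEnd ℂ) (q (x * ξ)) * deriv G (x * ξ)) * h4
      rw [mul_comm (deriv G (x * ξ) * ξ), h5, Complex.re_ofReal_mul,
        mul_comm ((starRingEnd ℂ) (q (x * ξ)))]
    have hsq : StrictMonoOn (fun x : ℝ => ‖G (x * ξ) - a‖ ^ 2) (Icc 0 b) := by
      apply strictMonoOn_of_deriv_pos (convex_Icc _ _)
        (fun x hx => (hd x hx).continuousAt.continuousWithinAt)
      intro x hx
      rw [interior_Icc] at hx
      rw [(hd x (Ioo_subset_Icc_self hx)).deriv]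
      have := (hbs (ofReal_mul_mem_closedBall hξ (Ioo_subset_Icc_self hx))).2.2.2.2
      have := hx.1
      positivity
    intro x hx y hy hxy
    exact lt_of_pow_lt_pow_left₀ 2 (norm_nonneg _) (hsq hx hy hxy)
  · rw [hGq, norm_mul, norm_mul, hξ, mul_one, Complex.norm_real, Real.norm_eq_abs, abs_of_pos hb]
    exact mul_le_mul_of_nonneg_left
      (hbs (ofReal_mul_mem_closedBall hξ (right_mem_Icc.2 hb.le))).2.2.2.1.le hb.le
  · have h1 := Complex.norm_mul_exp_arg_mul_I (q (x * ξ) / q 0)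
    have h2 := Complex.norm_mul_exp_arg_mul_I (q 0)
    have h3 : q (x * ξ) = ‖q (x * ξ)‖ * Complex.exp (A (x * ξ) * Complex.I) := by
      simp only [hA]
      rw [Complex.log_im, Complex.ofReal_add, add_mul, Complex.exp_add]
      rw [norm_div, Complex.ofReal_div] at h1
      have h4 : (‖q 0‖ : ℂ) ≠ 0 := by exact_mod_cast hq0n.ne'
      calc q (x * ξ) = (q (x * ξ) / q 0) * q 0 := by field_simp
        _ = (‖q (x * ξ)‖ / ‖q 0‖ * Complex.exp ((q (x * ξ) / q 0).arg * Complex.I)) *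
            (‖q 0‖ * Complex.exp ((q 0).arg * Complex.I)) := by rw [h1, h2]
        _ = _ := by field_simp
    rw [← sub_eq_iff_eq_add', hGq, norm_mul, norm_mul, hξ, mul_one, Complex.norm_real,
      Real.norm_eq_abs, abs_of_nonneg hx.1, Complex.ofReal_mul]
    conv_lhs => rw [h3]
    ring

end IsNaturalChart

/-! ### Sectors between graphs in polar coordinates -/

/-- The graph `θ = α r`, `0 ≤ r < R`, in polar coordinates around `a`. -/
def polarGraph (a : ℂ) (R : ℝ) (α : ℝ → ℝ) : Set ℂ :=
  (fun r : ℝ => a + r * Complex.exp (α r * Complex.I)) '' Ico 0 R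

/-- The region `α r < θ < β r`, `0 < r < R`, in polar coordinates around `a`. -/
def polarSector (a : ℂ) (R : ℝ) (α β : ℝ → ℝ) : Set ℂ :=
  {z | ∃ r ∈ Ioo 0 R, ∃ θ ∈ Ioo (α r) (β r), z = a + r * Complex.exp (θ * Complex.I)}

theorem polar_eq_iff {a : ℂ} {r r' θ θ' : ℝ} (hr : 0 < r) (hr' : 0 ≤ r')
    (h : a + r * Complex.exp (θ * Complex.I) = a + r' * Complex.exp (θ' * Complex.I)) :
    r = r' ∧ ∃ n : ℤ, θ = θ' + n * (2 * Real.pi) := by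
  have h1 := add_left_cancel h
  have hrr : r = r' := by
    have := congrArg norm h1
    simpa [Complex.norm_exp_ofReal_mul_I, abs_of_pos hr, abs_of_nonneg hr'] using this
  refine ⟨hrr, ?_⟩
  rw [← hrr] at h1
  have h2 := mul_left_cancel₀ (by exact_mod_cast hr.ne' : (r : ℂ) ≠ 0) h1
  obtain ⟨n, hn⟩ := Complex.exp_eq_exp_iff_exists_int.1 h2
  refine ⟨n, ?_⟩
  have h3 : (θ : ℂ) = θ' + n * (2 * Real.pi) := by
    apply mul_right_cancel₀ Complex.I_ne_zero
    rw [hn]; ring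
  exact_mod_cast h3

theorem eq_of_mem_Ico_of_eq_add_int_mul {c θ θ' p : ℝ} {n : ℤ} (hp : 0 < p)
    (hθ : θ ∈ Ico c (c + p)) (hθ' : θ' ∈ Ico c (c + p)) (h : θ = θ' + n * p) : θ = θ' := by
  have h1 : (n : ℝ) < 1 := by
    by_contra hn
    push Not at hn
    nlinarith [hθ.2, hθ'.1]
  have h2 : (-1 : ℝ) < n := by
    by_contra hn
    push Not at hn
    nlinarith [hθ.1, hθ'.2]
  have h3 : n = 0 := by
    have h1' : n < 1 := by exact_mod_cast h1
    have h2' : -1 < n := by exact_mod_cast h2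
    omega
  rw [h, h3]; simp

theorem exists_le_lt_succ {β : ℕ → ℝ} {θ : ℝ} (h0 : β 0 ≤ θ) :
    ∀ m : ℕ, θ < β m → ∃ k < m, β k ≤ θ ∧ θ < β (k + 1)
  | 0, hm => absurd hm (not_lt.2 h0)
  | m + 1, hm => by
    by_cases h : β m ≤ θ
    · exact ⟨m, Nat.lt_succ_self m, h, hm⟩
    · obtain ⟨k, hk, h1⟩ := exists_le_lt_succ h0 m (not_le.1 h)
      exact ⟨k, hk.trans (Nat.lt_succ_self m), h1⟩

section Sectors

variable {a : ℂ} {R : ℝ} {m : ℕ} {α : ℕ → ℝ → ℝ}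

theorem strictMono_apply_of_lt_succ (hlt : ∀ k, ∀ r ∈ Ico 0 R, α k r < α (k + 1) r) {r : ℝ}
    (hr : r ∈ Ico 0 R) : StrictMono fun k => α k r :=
  strictMono_nat_of_lt_succ fun k => hlt k r hr

theorem mem_Ico_of_mem_sector (hlt : ∀ k, ∀ r ∈ Ico 0 R, α k r < α (k + 1) r)
    (hper : ∀ k, ∀ r ∈ Ico 0 R, α (k + m) r = α k r + 2 * Real.pi) {r θ : ℝ}
    (hr : r ∈ Ico 0 R) {k : ℕ} (hk : k < m) (hθ : θ ∈ Ico (α k r) (α (k + 1) r)) :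
    θ ∈ Ico (α 0 r) (α 0 r + 2 * Real.pi) := by
  have hmono := strictMono_apply_of_lt_succ hlt hr
  refine ⟨(hmono.monotone (Nat.zero_le k)).trans hθ.1, hθ.2.trans_le ?_⟩
  rw [← hper 0 r hr, zero_add]
  exact hmono.monotone hk

/-- All the angles lie in one window of length 2π, where polar coordinates are unique. The angle
intervals include their left ends, so the same statement separates sectors from each other and from
the bounding curves. -/
theorem index_eq_of_polar_eq (hlt : ∀ k, ∀ r ∈ Ico 0 R, α k r < α (k + 1) r)
    (hper : ∀ k, ∀ r ∈ Ico 0 R, α (k + m) r = α k r + 2 * Real.pi) {r r' θ θ' : ℝ}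
    (hr : r ∈ Ioo 0 R) (hr' : r' ∈ Ico 0 R) {j k : ℕ} (hj : j < m) (hk : k < m)
    (hθ : θ ∈ Ico (α j r) (α (j + 1) r)) (hθ' : θ' ∈ Ico (α k r') (α (k + 1) r'))
    (h : a + r * Complex.exp (θ * Complex.I) = a + r' * Complex.exp (θ' * Complex.I)) :
    r = r' ∧ θ = θ' ∧ j = k := by
  obtain ⟨hrr, n, hn⟩ := polar_eq_iff hr.1 hr'.1 h
  subst hrr
  have heq := eq_of_mem_Ico_of_eq_add_int_mul Real.two_pi_pos
    (mem_Ico_of_mem_sector hlt hper hr' hj hθ) (mem_Ico_of_mem_sector hlt hper hr' hk hθ') hn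
  subst heq
  have hmono := strictMono_apply_of_lt_succ hlt hr'
  refine ⟨rfl, rfl, le_antisymm ?_ ?_⟩
  · exact Nat.lt_succ_iff.1 (hmono.lt_iff_lt.1 (hθ.1.trans_lt hθ'.2))
  · exact Nat.lt_succ_iff.1 (hmono.lt_iff_lt.1 (hθ'.1.trans_lt hθ.2))

theorem isSectorOfAngle_polarSector (hm : 1 ≤ m) (hc : ∀ k, ContinuousOn (α k) (Ico 0 R))
    (hlt : ∀ k, ∀ r ∈ Ico 0 R, α k r < α (k + 1) r)
    (hper : ∀ k, ∀ r ∈ Ico 0 R, α (k + m) r = α k r + 2 * Real.pi) {η : ℝ} (k : ℕ)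
    (hη : α (k + 1) 0 - α k 0 = η) :
    IsSectorOfAngle a R (polarGraph a R (α k)) (polarGraph a R (α (k + 1))) η
      (polarSector a R (α k) (α (k + 1))) := by
  refine ⟨α k, α (k + 1), hc k, hc (k + 1), fun r hr => ⟨hlt k r hr, ?_⟩, hη, rfl, rfl, rfl⟩
  rw [← hper k r hr]
  exact (strictMono_apply_of_lt_succ hlt hr).monotone (Nat.add_le_add_left hm k)

theorem disjoint_polarSector (hlt : ∀ k, ∀ r ∈ Ico 0 R, α k r < α (k + 1) r)
    (hper : ∀ k, ∀ r ∈ Ico 0 R, α (k + m) r = α k r + 2 * Real.pi) {j k : ℕ} (hj : j < m)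
    (hk : k < m) (hjk : j ≠ k) :
    Disjoint (polarSector a R (α j) (α (j + 1))) (polarSector a R (α k) (α (k + 1))) := by
  rw [Set.disjoint_left]
  rintro z ⟨r, hr, θ, hθ, rfl⟩ ⟨r', hr', θ', hθ', h⟩
  exact hjk (index_eq_of_polar_eq hlt hper hr (Ioo_subset_Ico_self hr') hj hk
    (Ioo_subset_Ico_self hθ) (Ioo_subset_Ico_self hθ') h).2.2

theorem iUnion_polarSector (hR : 0 < R) (hm : 1 ≤ m)
    (hlt : ∀ k, ∀ r ∈ Ico 0 R, α k r < α (k + 1) r)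
    (hper : ∀ k, ∀ r ∈ Ico 0 R, α (k + m) r = α k r + 2 * Real.pi) :
    ⋃ k : Fin m, polarSector a R (α k) (α (k + 1)) =
      Metric.ball a R \ ⋃ k : Fin m, polarGraph a R (α k) := by
  ext z
  simp only [mem_iUnion, Set.mem_sdiff, not_exists]
  constructor
  · rintro ⟨j, r, hr, θ, hθ, rfl⟩
    refine ⟨?_, ?_⟩
    · rw [Metric.mem_ball, dist_eq_norm, add_sub_cancel_left, norm_mul,
        Complex.norm_exp_ofReal_mul_I, mul_one, Complex.norm_real, Real.norm_eq_abs,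
        abs_of_pos hr.1]
      exact hr.2
    · rintro k ⟨r', hr', h⟩
      have h1 := index_eq_of_polar_eq hlt hper hr hr' j.2 k.2 (Ioo_subset_Ico_self hθ)
        (left_mem_Ico.2 (hlt k r' hr')) h.symm
      obtain ⟨rfl, h2, h3⟩ := h1
      rw [h2, h3] at hθ
      exact lt_irrefl _ hθ.1
  · rintro ⟨hz, hzk⟩
    have hza : z ≠ a := by
      rintro rfl
      exact hzk ⟨0, hm⟩ ⟨0, left_mem_Ico.2 hR, by simp⟩
    set r := ‖z - a‖ with hr
    have hr0 : 0 < r := norm_pos_iff.2 (sub_ne_zero.2 hza)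
    have hrR : r < R := by rwa [Metric.mem_ball, dist_eq_norm] at hz
    have hrI : r ∈ Ico 0 R := ⟨hr0.le, hrR⟩
    -- The window of angles starts at the curve α 0 and so moves with r.
    set θ := toIcoMod Real.two_pi_pos (α 0 r) (Complex.arg (z - a)) with hθ
    have hθI : θ ∈ Ico (α 0 r) (α 0 r + 2 * Real.pi) := toIcoMod_mem_Ico _ _ _
    have hzθ : z = a + r * Complex.exp (θ * Complex.I) := by
      have h1 := Complex.norm_mul_exp_arg_mul_I (z - a)
      rw [← sub_eq_iff_eq_add', ← h1]
      congr 1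
      rw [hθ, toIcoMod, Complex.exp_eq_exp_iff_exists_int]
      refine ⟨toIcoDiv Real.two_pi_pos (α 0 r) (Complex.arg (z - a)), ?_⟩
      rw [zsmul_eq_mul]
      push_cast
      ring
    obtain ⟨k, hk, h1, h2⟩ := exists_le_lt_succ (β := fun k => α k r) hθI.1 m (by
      have := hper 0 r hrI
      rw [zero_add] at this
      rw [this]; exact hθI.2)
    refine ⟨⟨k, hk⟩, r, ⟨hr0, hrR⟩, θ, ⟨lt_of_le_of_ne h1 ?_, h2⟩, hzθ⟩
    intro h3
    refine hzk ⟨k, hk⟩ ⟨r, hrI, ?_⟩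
    simp only at h3 ⊢
    rw [h3, ← hzθ]

end Sectors

/-! ### Separatrices and their sectors -/

/-- The `k`-th power of the primitive `m`-th root of unity `exp (2πi / m)`. -/
def unitRoot (m k : ℕ) : ℂ := Complex.exp ((2 * Real.pi * k / m : ℝ) * Complex.I)

theorem unitRoot_eq_pow (m k : ℕ) :
    unitRoot m k = Complex.exp (2 * Real.pi * Complex.I / m) ^ k := by
  rw [unitRoot, ← Complex.exp_nat_mul]
  congr 1
  push_cast
  ring

theorem unitRoot_pow {m : ℕ} (hm : 1 ≤ m) (k : ℕ) : unitRoot m k ^ m = 1 := by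
  rw [unitRoot_eq_pow, pow_right_comm,
    (Complex.isPrimitiveRoot_exp m (by omega)).pow_eq_one, one_pow]

theorem unitRoot_add {m : ℕ} (hm : 1 ≤ m) (k : ℕ) : unitRoot m (k + m) = unitRoot m k := by
  rw [unitRoot_eq_pow, unitRoot_eq_pow, pow_add,
    (Complex.isPrimitiveRoot_exp m (by omega)).pow_eq_one, mul_one]

theorem norm_unitRoot (m k : ℕ) : ‖unitRoot m k‖ = 1 := Complex.norm_exp_ofReal_mul_I _

theorem unitRoot_injective {m : ℕ} (hm : 1 ≤ m) :
    Function.Injective fun k : Fin m => unitRoot m k := by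
  intro j k h
  simp only [unitRoot_eq_pow] at h
  exact Fin.ext ((Complex.isPrimitiveRoot_exp m (by omega)).pow_inj j.2 k.2 h)

theorem exists_unitRoot_eq {m : ℕ} (hm : 1 ≤ m) {ξ : ℂ} (hξ : ξ ^ m = 1) :
    ∃ k : Fin m, unitRoot m k = ξ := by
  have : NeZero m := ⟨by omega⟩
  obtain ⟨k, hk, h⟩ := (Complex.isPrimitiveRoot_exp m (by omega)).eq_pow_of_pow_eq_one hξ
  exact ⟨⟨k, hk⟩, by rw [unitRoot_eq_pow]; exact h⟩

theorem unitRoot_finRotate {m : ℕ} (hm : 1 ≤ m) (k : Fin m) :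
    unitRoot m (finRotate m k) = unitRoot m (k + 1) := by
  obtain ⟨n, rfl⟩ := Nat.exists_eq_add_of_le' hm
  rw [coe_finRotate]
  split_ifs with h
  · have := unitRoot_add hm 0
    rw [zero_add] at this
    rw [← this, h]
    rfl
  · rfl

/-- The rays through consecutive roots of unity are 2π/m apart and G turns each by A(0) + o(1):
small deviations keep the order, and equality in the limit gives the equal angles. -/
theorem IsNaturalChart.exists_sectors {N m : ℕ} {d : ℤ} {a : ℂ} {ρ r₀ : ℝ} {G V : ℂ → ℂ}
    {D : Set ℂ} {f : ℂ → WithZero (NDirection N)}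
    (h : IsNaturalChart N d (reprField f) a ρ G V) (hN : 1 ≤ N) (hm : 1 ≤ m)
    (hd : (m : ℤ) + d = N) (hfa : f a = 0) (hGD : ∀ y ∈ Metric.ball (0 : ℂ) ρ, G y ∈ D)
    (hr₀ : 0 < r₀) (hball : Metric.ball a r₀ ⊆ D) :
    ∃ (R : ℝ) (γ : Fin m → ℝ → ℂ) (T : Fin m → ℝ) (S : Fin m → Set ℂ),
      0 < R ∧ Metric.ball a R ⊆ D ∧
      (∀ k, IsStreamline D f (γ k) 0 (T k) ∧ γ k 0 = a) ∧
      Set.BijOn (fun k => (γ k : Filter.Germ (nhdsWithin (0 : ℝ) (Set.Ici 0)) ℂ)) Set.univ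
        (outgoingSeparatrices D f a) ∧
      (∀ k, IsSectorOfAngle a R (γ k '' Set.Ico 0 (T k))
        (γ (finRotate _ k) '' Set.Ico 0 (T (finRotate _ k))) (2 * Real.pi / m) (S k)) ∧
      Pairwise (fun j k => Disjoint (S j) (S k)) ∧
      ⋃ k, S k = Metric.ball a R \ ⋃ k, γ k '' Set.Ico 0 (T k) := by
  have hm0 : (0 : ℝ) < m := by exact_mod_cast hm
  -- With deviations below π/m, neighboring curves cannot meet.
  obtain ⟨b, hb, R', hR', A, hAc, hAε, hray⟩ :=
    h.exists_polar_angle (ε := Real.pi / m) (by positivity)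
  set R := min R' r₀ with hR
  have hR0 : 0 < R := lt_min hR' hr₀
  -- P ξ r is the parameter at which the image of the ray has distance r from a.
  set P : ℂ → ℝ → ℝ := fun ξ => Function.invFunOn (fun x : ℝ => ‖G (x * ξ) - a‖) (Icc 0 b) with hP
  have hn0 : ∀ ξ : ℂ, ‖G ((0 : ℝ) * ξ) - a‖ = 0 := by intro ξ; simp [h.map_zero]
  have hPspec : ∀ ξ : ℂ, ‖ξ‖ = 1 → ContinuousOn (P ξ) (Icc 0 R) ∧
      MapsTo (P ξ) (Icc 0 R) (Icc 0 b) ∧ (∀ x ∈ Icc 0 R, ‖G (P ξ x * ξ) - a‖ = x) ∧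
      ∀ x ∈ Icc 0 b, P ξ ‖G (x * ξ) - a‖ = x := by
    intro ξ hξ
    obtain ⟨h1, h2, h3, h4⟩ := invFunOn_Icc (φ := fun x : ℝ => ‖G (x * ξ) - a‖) hb.1.le
      ((h.differentiableOn.continuousOn.comp (by fun_prop) (fun x hx =>
        ofReal_mul_mem_ball hξ (h.Icc_subset hb.2 hx))).sub continuousOn_const).norm (hray ξ hξ).1
    simp only [hn0] at h1 h2 h3
    have hsub : Icc 0 R ⊆ Icc 0 ‖G (b * ξ) - a‖ :=
      Icc_subset_Icc_right ((min_le_left _ _).trans (hray ξ hξ).2.1)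
    exact ⟨h1.mono hsub, h2.mono_left hsub, fun x hx => h3 x (hsub hx), h4⟩
  have hP0 : ∀ ξ : ℂ, ‖ξ‖ = 1 → P ξ 0 = 0 := by
    intro ξ hξ
    have := (hPspec ξ hξ).2.2.2 0 (left_mem_Icc.2 hb.1.le)
    rwa [hn0] at this
  have hB : ∀ ξ : ℂ, ‖ξ‖ = 1 → P ξ R ∈ Ioo 0 ρ := by
    intro ξ hξ
    obtain ⟨-, h2, h3, -⟩ := hPspec ξ hξ
    have h5 := h2 (right_mem_Icc.2 hR0.le)
    refine ⟨lt_of_le_of_ne h5.1 fun h6 => ?_, h5.2.trans_lt hb.2⟩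
    have h7 := h3 R (right_mem_Icc.2 hR0.le)
    rw [← h6, hn0] at h7
    exact hR0.ne h7
  -- Indexing by ℕ instead of residues mod m keeps the angles increasing; a shift of k by m adds 2π
  -- on the same curve, which closes up the last sector.
  set α : ℕ → ℝ → ℝ := fun k r => 2 * Real.pi * k / m + A (P (unitRoot m k) r * unitRoot m k)
    with hα
  have hmem : ∀ k : ℕ, ∀ r ∈ Icc 0 R,
      (P (unitRoot m k) r * unitRoot m k : ℂ) ∈ Metric.closedBall (0 : ℂ) b := fun k r hr =>
    ofReal_mul_mem_closedBall (norm_unitRoot m k) ((hPspec _ (norm_unitRoot m k)).2.1 hr)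
  have hαc : ∀ k, ContinuousOn (α k) (Ico 0 R) := by
    intro k
    refine continuousOn_const.add (hAc.comp ?_ fun r hr => hmem k r (Ico_subset_Icc_self hr))
    exact (Complex.continuous_ofReal.comp_continuousOn
      ((hPspec _ (norm_unitRoot m k)).1.mono Ico_subset_Icc_self)).mul continuousOn_const
  have hαlt : ∀ k, ∀ r ∈ Ico 0 R, α k r < α (k + 1) r := by
    intro k r hr
    have h1 := (abs_lt.1 (hAε _ (hmem k r (Ico_subset_Icc_self hr)))).2
    have h2 := (abs_lt.1 (hAε _ (hmem (k + 1) r (Ico_subset_Icc_self hr)))).1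
    have h3 : 2 * Real.pi * ((k + 1 : ℕ) : ℝ) / m = 2 * Real.pi * k / m + Real.pi / m + Real.pi / m := by
      push_cast; ring
    simp only [hα]
    rw [h3]
    linarith
  have hαper : ∀ k, ∀ r ∈ Ico 0 R, α (k + m) r = α k r + 2 * Real.pi := by
    intro k r _
    simp only [hα]
    rw [unitRoot_add hm]
    push_cast
    rw [mul_add, add_div, mul_div_cancel_right₀ _ hm0.ne']
    ring
  have hαang : ∀ k, α (k + 1) 0 - α k 0 = 2 * Real.pi / m := by
    intro k
    simp only [hα]
    rw [hP0 _ (norm_unitRoot m k), hP0 _ (norm_unitRoot m (k + 1)), Complex.ofReal_zero,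
      zero_mul, zero_mul]
    push_cast
    ring
  -- Each ray is cut where its image reaches distance R from a, so that the half-open curve is
  -- exactly the part inside the disc.
  set γ : ℂ → ℝ → ℂ := fun ξ => ray G ξ (P ξ R) with hγ
  set T : ℂ → ℝ := fun ξ => rayTime G ξ (P ξ R) with hT
  have hgraph : ∀ k : ℕ, γ (unitRoot m k) '' Ico 0 (T (unitRoot m k)) = polarGraph a R (α k) := by
    intro k
    have hξ := norm_unitRoot m k
    simp only [hγ, hT]
    rw [h.ray_image hξ (hB _ hξ)]
    obtain ⟨-, h2, h3, h4⟩ := hPspec _ hξ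
    have hstrict := (hray _ hξ).1
    have hpoint : ∀ r ∈ Icc 0 R, G (P (unitRoot m k) r * unitRoot m k) =
        a + r * Complex.exp (α k r * Complex.I) := by
      intro r hr
      have h5 := (hray _ hξ).2.2 _ (h2 hr)
      rw [h3 r hr] at h5
      rw [h5]
      congr 2
      simp only [hα]
      rw [Complex.ofReal_add, add_mul, Complex.exp_add]
      rfl
    ext z
    constructor
    · rintro ⟨x, hx, rfl⟩
      have hPR := h2 (right_mem_Icc.2 hR0.le)
      have hx' : x ∈ Icc 0 b := ⟨hx.1, hx.2.le.trans hPR.2⟩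
      have h5 : ‖G (x * unitRoot m k) - a‖ < R := by
        have := hstrict hx' hPR hx.2
        simp only at this
        rwa [h3 R (right_mem_Icc.2 hR0.le)] at this
      refine ⟨‖G (x * unitRoot m k) - a‖, ⟨norm_nonneg _, h5⟩, ?_⟩
      simp only
      rw [← hpoint _ ⟨norm_nonneg _, h5.le⟩, h4 x hx']
    · rintro ⟨r, hr, rfl⟩
      have hr' := Ico_subset_Icc_self hr
      refine ⟨P (unitRoot m k) r, ⟨(h2 hr').1, ?_⟩, hpoint r hr'⟩
      rw [← hstrict.lt_iff_lt (h2 hr') (h2 (right_mem_Icc.2 hR0.le))]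
      rw [h3 r hr', h3 R (right_mem_Icc.2 hR0.le)]
      exact hr.2
  refine ⟨R, fun k => γ (unitRoot m k), fun k => T (unitRoot m k),
    fun k => polarSector a R (α k) (α (k + 1)), hR0,
    (Metric.ball_subset_ball (min_le_right _ _)).trans hball, fun k => ⟨?_, ?_⟩, ⟨?_, ?_, ?_⟩,
    fun k => ?_, fun j k hjk => ?_, ?_⟩
  · exact h.ray_isStreamline hm hd hGD (unitRoot_pow hm k) (hB _ (norm_unitRoot m k))
  · exact h.ray_zero (norm_unitRoot m k) (hB _ (norm_unitRoot m k))
  · intro k _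
    refine ⟨γ (unitRoot m k), 0, T (unitRoot m k),
      h.ray_isStreamline hm hd hGD (unitRoot_pow hm k) (hB _ (norm_unitRoot m k)),
      h.ray_zero (norm_unitRoot m k) (hB _ (norm_unitRoot m k)), ?_⟩
    simp only [zero_add]
  · intro j _ k _ hjk
    exact unitRoot_injective hm (h.eq_of_ray_eventuallyEq (norm_unitRoot m j) (norm_unitRoot m k)
      (hB _ (norm_unitRoot m j)) (hB _ (norm_unitRoot m k)) (Filter.Germ.coe_eq.1 hjk))
  · rintro _ ⟨σ, s, t, hσ, hσs, rfl⟩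
    obtain ⟨ξ, hξm, hξ⟩ := h.streamline_eventuallyEq_ray hN hm hd hfa hσ hσs
    obtain ⟨k, rfl⟩ := exists_unitRoot_eq hm hξm
    refine ⟨k, mem_univ _, ?_⟩
    exact Filter.Germ.coe_eq.2 ((hξ _ (hB _ (norm_unitRoot m k))).mono fun τ hτ => hτ.symm)
  · simp only
    -- The rotated index names the next curve cyclically; for m = 1 it is the same curve, and the
    -- sector is the disc slit along it.
    rw [unitRoot_finRotate hm, hgraph, hgraph]
    exact isSectorOfAngle_polarSector hm hαc hαlt hαper k (hαang k)
  · exact disjoint_polarSector hαlt hαper j.2 k.2 fun hc => hjk (Fin.ext hc)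
  · simp only [hgraph]
    exact iUnion_polarSector hR0 hm hαlt hαper

/-- At an interior zero of index `d / N`, an aligned canonical field has a natural chart. -/
theorem exists_isNaturalChart_of_singularity {N m : ℕ} (hN : 1 ≤ N) (hm : 1 ≤ m) {D : Set ℂ}
    {f : ℂ → WithZero (NDirection N)} (hf : IsAlignedCanonicalField D f) {a : ℂ} {d : ℤ}
    (ha : IsInteriorSingularity D f a ((d : ℝ) / N)) (hd : (m : ℤ) + d = N) (hD : IsOpen D) :
    ∃ ρ G V, IsNaturalChart N d (reprField f) a ρ G V ∧
      ∀ y ∈ Metric.ball (0 : ℂ) ρ, G y ∈ D := by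
  obtain ⟨Ω, hΩD, hΩ, ⟨g, n, c, e, -, hinj, -, hcan⟩, hne⟩ := hf.canonical
  -- A zero cannot lie in D \ Ω, nor where u is circle-valued harmonic, so a is one of the
  -- prescribed singular points.
  have haΩ : a ∈ Ω := by
    by_contra h
    exact hne a ⟨ha.mem, h⟩ ha.zero
  obtain ⟨j, rfl⟩ : a ∈ range c := by
    by_contra h
    obtain ⟨φ, -, hφ⟩ := hcan.canonical.harmonic a ⟨haΩ, h⟩
    have h1 := hφ.self_of_nhds
    rw [(reprField_eq_zero_iff f a).2 ha.zero] at h1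
    exact Complex.exp_ne_zero _ h1.symm
  obtain ⟨α, hα, C, hest⟩ := hcan.canonical.estimate j
  have hN0 : (N : ℝ) ≠ 0 := by exact_mod_cast (by omega : N ≠ 0)
  have hde : d = e j := by
    refine winding_eq_exponent hα hest (ha.index.mono ?_)
    rintro r ⟨ϑ, h1, h2, h3⟩
    refine ⟨ϑ, h1, h2, ?_⟩
    have := Real.pi_pos.ne'
    field_simp at h3
    linarith
  have hharm : ∀ᶠ z in 𝓝[≠] (c j), IsCircleHarmonicAt (reprField f) z := by
    have h1 : ∀ᶠ z in 𝓝 (c j), z ∉ c '' {j}ᶜ := by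
      refine ((Set.toFinite _).isClosed.isOpen_compl).mem_nhds ?_
      rintro ⟨i, hi, hij⟩
      exact hi (hinj hij)
    filter_upwards [h1.filter_mono nhdsWithin_le_nhds,
      nhdsWithin_le_nhds (hΩ.isOpen.mem_nhds haΩ), self_mem_nhdsWithin] with z hz hzΩ hzj
    refine hcan.canonical.harmonic z ⟨hzΩ, ?_⟩
    rintro ⟨i, rfl⟩
    refine hz ⟨i, ?_, rfl⟩
    rintro rfl
    exact hzj rfl
  obtain ⟨r, hr, H, hH, hu⟩ := exists_local_form hα hharm hest
  rw [← hde] at hu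
  exact exists_isNaturalChart hN hm hd hr hH hu (hD.mem_nhds ha.mem)

end

theorem mainTheorem5 (N : ℕ) (hN : 1 ≤ N) (D : Set ℂ) (hD : IsPiecewiseSmoothDomain D)
    (f : ℂ → WithZero (NDirection N)) (hf : IsAlignedCanonicalField D f)
    (a : ℂ) (d : ℤ) (ha : IsInteriorSingularity D f a ((d : ℝ) / N)) (hd : d < N) :
    (outgoingSeparatrices D f a).ncard = (N - d).toNat ∧
    (Even N → incomingSeparatrices D f a = outgoingSeparatrices D f a) ∧
    ∃ (R : ℝ) (γ : Fin (N - d).toNat → ℝ → ℂ) (T : Fin (N - d).toNat → ℝ)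
      (S : Fin (N - d).toNat → Set ℂ),
      0 < R ∧ Metric.ball a R ⊆ D ∧
      (∀ k, IsStreamline D f (γ k) 0 (T k) ∧ γ k 0 = a) ∧
      Set.BijOn (fun k => (γ k : Filter.Germ (nhdsWithin (0 : ℝ) (Set.Ici 0)) ℂ)) Set.univ
        (outgoingSeparatrices D f a) ∧
      (∀ k, IsSectorOfAngle a R (γ k '' Set.Ico 0 (T k)) (γ (finRotate _ k) '' Set.Ico 0 (T (finRotate _ k)))
        (2 * Real.pi / (N - d)) (S k)) ∧
      Pairwise (fun j k => Disjoint (S j) (S k)) ∧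
      ⋃ k, S k = Metric.ball a R \ ⋃ k, γ k '' Set.Ico 0 (T k) := by
  -- Since d < N, `toNat` truncates nothing and the number of separatrices is positive.
  have hmd : (((N - d : ℤ).toNat : ℤ)) + d = N := by omega
  have hm : 1 ≤ (N - d : ℤ).toNat := by omega
  have hreal : ((N : ℝ) - d) = ((N - d : ℤ).toNat : ℝ) := by
    have : (((N - d : ℤ).toNat : ℤ) : ℝ) + d = N := by exact_mod_cast hmd
    rw [Int.cast_natCast] at this
    linarith
  obtain ⟨ρ, G, V, h, hGD⟩ := exists_isNaturalChart_of_singularity hN hm hf ha hmd hD.isOpen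
  obtain ⟨r₀, hr₀, hball⟩ := Metric.isOpen_iff.1 hD.isOpen a ha.mem
  obtain ⟨R, γ, T, S, h1, h2, h3, h4, h5, h6, h7⟩ :=
    h.exists_sectors hN hm hmd ha.zero hGD hr₀ hball
  refine ⟨?_, fun hE => incomingSeparatrices_eq_outgoingSeparatrices hE D f a,
    R, γ, T, S, h1, h2, h3, h4, ?_, h6, h7⟩
  · rw [← h4.image_eq, h4.injOn.ncard_image, Set.ncard_univ, Nat.card_fin]
  · rw [hreal]
    exact h5
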